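/- Let $n\ge 1$, $[n]=\{1,\dots,n\}$, and let trees be labeled trees on the vertex set $[n]$. In the local orientation an edge $\{i,j\}$ with $i<j$ is oriented $i\to j$; for a tree rooted at $1$, the global orientation directs each edge towards $1$ (from child to parent). The local indegree sequence of a tree is the partition $1^{e_1}2^{e_2}\cdots$ of $n-1$, where $e_i$ is the number of vertices of local indegree $i$ ($i\ge1$). For a partition $\lambda=1^{e_1}2^{e_2}\cdots$ of $n-1$ of length $\ell(\lambda)=\sum_{i\ge1}e_i$, let $\mathcal T_{n,\lambda}$ be the set of (unrooted) trees with local indegree sequence $\lambda$, let $\Pi^{(1)}_{n,\lambda}$ be the set of set partitions of $\{2,\dots,n\}$ with exactly $e_i$ blocks of size $i$ for each $i\ge 1$, and let $\mathcal S^{(1)}_{n,k}$ be the set of sequences $(p_1,\dots,p_k)$ of distinct elements of $[n]$ with $p_k=1$ (for $k=0$, only the empty sequence). Define the following maps. * $\phi_{glo}(T)$, for $T$ rooted at $1$, is the set of the nonempty sets of children of the vertices of $T$. * $\phi_{loc}(T)$: hang up $T$ at $1$ and label each edge by its end point farther from $1$; $\phi_{loc}(T)$ is the set of the nonempty sets among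 the sets (one for each vertex $v$) of the labels of the edges that point to $v$ in the local orientation. It is called the local sibship partition of $T$. * $\Phi_1$: hang up $T$ at $1$. Call an edge good if its local orientation points towards $1$. Removing the good edges leaves increasing trees, each rooted at its vertex closest to $1$. Let $v_1,\dots,v_l$ be the vertices of an increasing tree in postorder (recursively: the subtrees of the children of the root in increasing order of these children, then the root), and let $\sigma$ be the product, over all increasing trees, of the cycles $(v_1,\dots,v_l)$, that is $v_1\mapsto v_2\mapsto\dots\mapsto v_l\mapsto v_1$. Then $\Phi_1(T)$ is the tree rooted at $1$ whose edges are the $v_i\to v_{i+1}$ ($1\le i<l$), for all increasing trees, and the $i\to\sigma(j)$, for all good edges $i\to j$ of $T$. * $\psi(T)$, for $T$ rooted at $1$, is the sequence $(p_1,p_2,\dots)$ obtained by repeatedly deleting the largest leaf-group (a leaf-group is a nonempty set of all children of a vertex, all of them leaves; leaf-groups are ordered by their maxima) and recording its parent, until only the root remains. Then the following hold. 1. For each partition $\lambda=1^{e_1}2^{e_2}\cdots$ of $n-1$, the map $T\mapsto\bigl(\phi_{glo}(\Phi_1(T)),\psi(\Phi_1(T))\bigr)$ is a bijection from $\mathcal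 T_{n,\lambda}$ to $\Pi^{(1)}_{n,\lambda}\times\mathcal S^{(1)}_{n,\ell(\lambda)}$, and, with $e_0=n-\ell(\lambda)$, $$|\mathcal T_{n,\lambda}|=\frac{(n-1)!^2}{\prod_{i\ge0}e_i!\,(i!)^{e_i}}.$$ 2. For each set partition $\pi$ of $\{2,\dots,n\}$, with $\ell$ blocks, $\Phi_1$ is a bijection from the set of trees $T$ with $\phi_{loc}(T)=\pi$ to the set of trees $T$ rooted at $1$ with $\phi_{glo}(T)=\pi$, and $\psi$ is a bijection from the latter set to $\mathcal S^{(1)}_{n,\ell}$. The number of trees with local sibship partition $\pi$ is therefore $\dfrac{(n-1)!}{(n-\ell)!}$. -/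

import Mathlib

/-!
Labeled trees on `[n] = {1, …, n}` are modelled as `T : SimpleGraph (Fin n)` with `T.IsTree`; the
element `i : Fin n` stands for the label `i + 1`, so that the label `1` is `0 : Fin n`.
A tree rooted at `r` is a tree together with the choice of the vertex `r`.
-/

namespace LabeledTree

variable {n : ℕ}

/-! ### Orientations of the edges -/

/-- The local orientation: an edge is oriented from its smaller to its larger end point. -/
def LocalArc (T : SimpleGraph (Fin n)) (i j : Fin n) : Prop :=
  T.Adj i j ∧ i < j

/-- The global orientation of a tree rooted at `r`: every edge is oriented towards the root.
`GlobalArc r T i j` says that `i` is a child of `j`. -/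
def GlobalArc (r : Fin n) (T : SimpleGraph (Fin n)) (i j : Fin n) : Prop :=
  T.Adj i j ∧ T.dist r j < T.dist r i

/-- `i → j` is a good edge: its local orientation `i → j` points towards the root `r`. -/
def GoodArc (r : Fin n) (T : SimpleGraph (Fin n)) (i j : Fin n) : Prop :=
  LocalArc T i j ∧ GlobalArc r T i j

/-- The edge between the child `i` and its parent `j` is bad: its local orientation `j → i` points
away from the root `r`. -/
def BadArc (r : Fin n) (T : SimpleGraph (Fin n)) (i j : Fin n) : Prop :=
  LocalArc T j i ∧ GlobalArc r T i j

open Classical in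
/-- The number of edges pointing to `v` in the local orientation. -/
noncomputable def localIndeg (T : SimpleGraph (Fin n)) (v : Fin n) : ℕ :=
  (Finset.univ.filter fun i => LocalArc T i v).card

/-! ### The sets of trees, set partitions and `k`-permutations -/

/-- `𝒯_{n,lam}`: the labeled trees with local indegree sequence `lam`, i.e. such that for each
`i ≥ 1` the multiplicity of `i` in `lam` is the number of vertices of local indegree `i`. -/
def treesOfLocalType (lam : Nat.Partition (n - 1)) : Set (SimpleGraph (Fin n)) :=
  {T | T.IsTree ∧ ∀ i, 1 ≤ i →
    (Finset.univ.filter fun v => localIndeg T v = i).card = lam.parts.count i}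

/-- `Π_{n,lam}^{(r)}`: the set partitions of `[n] ∖ {r}` of type `lam`, i.e. such that for each
`i ≥ 1` the multiplicity of `i` in `lam` is the number of blocks of size `i`. -/
def setPartitionsOfType (r : Fin n) (lam : Nat.Partition (n - 1)) :
    Set (Finset (Finset (Fin n))) :=
  {P | (∃ π : Finpartition (Finset.univ.erase r), π.parts = P) ∧
    ∀ i, 1 ≤ i → (P.filter fun B => B.card = i).card = lam.parts.count i}

/-- `𝒮_{n,k}^{(r)}`: the `k`-permutations `(p₁, …, p_k)` of `[n]` with `p_k = r`
(for `k = 0`, only the empty sequence). -/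
def kPerms (r : Fin n) (k : ℕ) : Set (List (Fin n)) :=
  {p | p.length = k ∧ p.Nodup ∧ ∀ x ∈ p.getLast?, x = r}

/-- The multiplicities `e_i` of `lam = 1^{e₁} 2^{e₂} ⋯`, with `e₀ = n - ℓ(lam)`. -/
def multiplicity (lam : Nat.Partition (n - 1)) (i : ℕ) : ℕ :=
  if i = 0 then n - lam.parts.card else lam.parts.count i

/-! ### Sibships -/

open Classical in
/-- The child-group of `v` in the tree `T` rooted at `r`. -/
noncomputable def childGroup (r : Fin n) (T : SimpleGraph (Fin n)) (v : Fin n) :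
    Finset (Fin n) :=
  Finset.univ.filter fun i => GlobalArc r T i v

/-- `φ_glo(T)`: the set of the nonempty child-groups. -/
noncomputable def phiGlo (r : Fin n) (T : SimpleGraph (Fin n)) : Finset (Finset (Fin n)) :=
  (Finset.univ.image (childGroup r T)).erase ∅

open Classical in
/-- The set of the labels of the edges that point locally to `v`. The label of an edge is its end
point farther from the root `r`: the edge between `u` and `w` has label `u` if `u → w` in the
global orientation. -/
noncomputable def localSibship (r : Fin n) (T : SimpleGraph (Fin n)) (v : Fin n) :
    Finset (Fin n) :=
  Finset.univ.filter fun k => ∃ i, LocalArc T i v ∧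
    ((k = i ∧ GlobalArc r T i v) ∨ (k = v ∧ GlobalArc r T v i))

/-- `φ_loc(T)`: the set of the nonempty local sibships. -/
noncomputable def phiLoc (r : Fin n) (T : SimpleGraph (Fin n)) : Finset (Finset (Fin n)) :=
  (Finset.univ.image (localSibship r T)).erase ∅

/-- `𝒯_loc^{(P)}`: the trees with local sibship set-partition `P`. -/
def treesOfLocalSibship (r : Fin n) (P : Finset (Finset (Fin n))) :
    Set (SimpleGraph (Fin n)) :=
  {T | T.IsTree ∧ phiLoc r T = P}

/-- `𝒯_glo^{(P)}`: the trees rooted at `r` with global sibship set-partition `P`. -/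
def treesOfGlobalSibship (r : Fin n) (P : Finset (Finset (Fin n))) :
    Set (SimpleGraph (Fin n)) :=
  {T | T.IsTree ∧ phiGlo r T = P}

/-! ### The map `Φ_r` -/

open Classical in
/-- The children of `v` in the increasing tree that contains `v` (the increasing trees are what
remains of `T` when the good edges are removed). -/
noncomputable def badChildren (r : Fin n) (T : SimpleGraph (Fin n)) (v : Fin n) :
    Finset (Fin n) :=
  Finset.univ.filter fun c => BadArc r T c v

theorem lt_of_mem_badChildren {r : Fin n} {T : SimpleGraph (Fin n)} {v c : Fin n}
    (h : c ∈ badChildren r T v) : v < c := by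
  classical
  simp only [badChildren, Finset.mem_filter] at h
  exact h.2.1.2

/-- The vertices of the subtree with root `v` of an increasing tree, in postorder: first the
subtrees of the children of `v`, by increasing children, and then `v`. -/
noncomputable def postorder (r : Fin n) (T : SimpleGraph (Fin n)) (v : Fin n) : List (Fin n) :=
  (((badChildren r T v).sort (· ≤ ·)).attach.flatMap fun c => postorder r T c.1) ++ [v]
termination_by n - v.val
decreasing_by
  have h : v < c.1 := lt_of_mem_badChildren ((Finset.mem_sort _).1 c.2)
  exact Nat.sub_lt_sub_left v.isLt h

open Classical in
/-- The roots of the increasing trees. -/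
noncomputable def increasingRoots (r : Fin n) (T : SimpleGraph (Fin n)) : Finset (Fin n) :=
  Finset.univ.filter fun v => ¬ ∃ u, BadArc r T v u

/-- The permutation `σ = σ₁ ⋯ σ_d`: the product of the disjoint cycles `(v₁, …, v_l)`, where
`v₁, …, v_l` are the vertices of an increasing tree in postorder. -/
noncomputable def sigma (r : Fin n) (T : SimpleGraph (Fin n)) : Equiv.Perm (Fin n) :=
  (((increasingRoots r T).sort (· ≤ ·)).map fun h => (postorder r T h).formPerm).prod

/-- The edges of `Φ_r(T)`, oriented towards the root: the edges `v_i → v_{i+1}` of the linear trees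
`v₁ → ⋯ → v_l`, and one edge `i → σ(j)` for each good edge `i → j` of `T`. -/
def PhiArc (r : Fin n) (T : SimpleGraph (Fin n)) (i k : Fin n) : Prop :=
  (∃ h ∈ increasingRoots r T, [i, k] <:+: postorder r T h) ∨
    ∃ j, GoodArc r T i j ∧ k = sigma r T j

/-- The map `Φ_r` from unrooted trees to trees rooted at `r`. -/
def Phi (r : Fin n) (T : SimpleGraph (Fin n)) : SimpleGraph (Fin n) :=
  SimpleGraph.fromRel (PhiArc r T)

/-! ### The paternity map `ψ` -/

/-- The vertices of the (partially deleted) rooted tree on the vertex set `V` whose child-group is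
a leaf-group: it is nonempty, and all the children are leaves. -/
noncomputable def leafGroupParents (r : Fin n) (T : SimpleGraph (Fin n)) (V : Finset (Fin n)) :
    Finset (Fin n) :=
  V.filter fun v => (childGroup r T v ∩ V).Nonempty ∧
    ∀ c ∈ childGroup r T v ∩ V, childGroup r T c ∩ V = ∅

/-- The parent of the largest leaf-group, where leaf-groups are ordered by their maxima. -/
noncomputable def largestLeafGroupParent (r : Fin n) (T : SimpleGraph (Fin n))
    (V : Finset (Fin n)) (h : (leafGroupParents r T V).Nonempty) : Fin n :=
  (Finset.exists_max_image _ (fun v => (childGroup r T v ∩ V).max) h).choose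

theorem largestLeafGroupParent_mem (r : Fin n) (T : SimpleGraph (Fin n))
    (V : Finset (Fin n)) (h : (leafGroupParents r T V).Nonempty) :
    largestLeafGroupParent r T V h ∈ leafGroupParents r T V :=
  (Finset.exists_max_image _ (fun v => (childGroup r T v ∩ V).max) h).choose_spec.1

/-- Delete repeatedly the largest leaf-group of the rooted tree on the remaining vertex set `V`,
recording its parent, until no leaf-group is left. -/
noncomputable def psiFrom (r : Fin n) (T : SimpleGraph (Fin n)) (V : Finset (Fin n)) :
    List (Fin n) :=
  if h : (leafGroupParents r T V).Nonempty then
    largestLeafGroupParent r T V h ::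
      psiFrom r T (V \ childGroup r T (largestLeafGroupParent r T V h))
  else []
termination_by V.card
decreasing_by
  have hp := largestLeafGroupParent_mem r T V h
  obtain ⟨c, hc⟩ := (Finset.mem_filter.1 hp).2.1
  rw [Finset.mem_inter] at hc
  refine Finset.card_lt_card (Finset.ssubset_iff_subset_ne.2 ⟨Finset.sdiff_subset, fun he => ?_⟩)
  have hV := hc.2
  rw [← he, Finset.mem_sdiff] at hV
  exact hV.2 hc.1

/-- The paternity map `ψ`. -/
noncomputable def psi (r : Fin n) (T : SimpleGraph (Fin n)) : List (Fin n) :=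
  psiFrom r T Finset.univ

/-- The map `(φ_glo, ψ) ∘ Φ_r`. -/
noncomputable def code (r : Fin n) (T : SimpleGraph (Fin n)) :
    Finset (Finset (Fin n)) × List (Fin n) :=
  (phiGlo r (Phi r T), psi r (Phi r T))

end LabeledTree

namespace LabeledTree

variable {n : ℕ}

/-! ### Trees and parent maps -/

/-! A tree rooted at `r` is encoded by its parent map `p`, with `p r = r`; conversely a map whose
iterates all reach its fixed point `r` is the parent map of a tree (`isParentMap_graphOfMap`). The
edge from `k` to `p k` has label `k` and points locally to `max k (p k)`, so the local sibships are
the nonempty fibers of `k ↦ max k (p k)` on the non-root vertices. The parent map of `Phi r T` is `k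
↦ σ (max k (p k))`. Since `σ` is a permutation, the fibers do not change as sets: the local sibships
of `T` are the child-groups of `Phi r T` (`phiGlo_phi`).

`Phi r T` is a tree because its parent map runs through the rest of a postorder up to the root of
the increasing tree, and then jumps into an increasing tree whose root is strictly closer to `r`.
`T` can be recovered from the parent map `q` of its image by induction from `r` outwards. If the
root of the increasing tree of `q v` is known, then `max v (p v)` is the maximum of that root and of
the siblings of `v` under `q` (with `v` itself). This tells whether `v` starts an increasing tree.
If it does and `v ≠ r`, then `p v` is that maximum. If it does not, `p v` is the first iterate of
`q` after `v` that is smaller than `v`, because in postorder only subtrees of larger siblings stand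
between `v` and its parent. So `Phi` is injective on the finite set of trees, hence bijective
(`bijOn_phi`).

For `ψ`, the leaf-groups at any stage are the remaining blocks that contain no remaining entry of
the sequence. Hence partition and sequence determine the order in which the blocks were deleted, and
with it all parents. For an arbitrary sequence in `kPerms` this decoding never gets stuck: `k`
disjoint blocks avoiding `r` cannot all meet a sequence of `k` entries one of which is `r`
(`exists_block_disjoint`). The relation `Decodes` carries both directions (`bijOn_psi`).

The cardinalities follow by counting sequences (`ncard_kPerms_mul`) and set partitions of a given
type (`ncard_partitionsOfType_mul`); local indegrees are the sizes of local sibships. -/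

/-- `p` sends every vertex other than `r` to its parent in the tree `T` rooted at `r`. -/
structure IsParentMap (r : Fin n) (T : SimpleGraph (Fin n)) (p : Fin n → Fin n) : Prop where
  isTree : T.IsTree
  map_root : p r = r
  globalArc_iff : ∀ i j, GlobalArc r T i j ↔ i ≠ r ∧ p i = j

theorem GlobalArc.dist_eq {r : Fin n} {T : SimpleGraph (Fin n)} (hT : T.IsTree) {i j : Fin n}
    (h : GlobalArc r T i j) : T.dist r i = T.dist r j + 1 := by
  rcases hT.dist_eq_dist_add_one_of_adj r h.1 with h1 | h1
  · exact h1
  · have := h.2; omega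

/-- Continuing either arc by a shortest walk gives a path to the root; a tree has only one, so the
second vertices agree. -/
theorem GlobalArc.parent_unique {r : Fin n} {T : SimpleGraph (Fin n)} (hT : T.IsTree)
    {i a b : Fin n} (ha : GlobalArc r T i a) (hb : GlobalArc r T i b) : a = b := by
  obtain ⟨wa, hwa⟩ := hT.connected.exists_walk_length_eq_dist a r
  obtain ⟨wb, hwb⟩ := hT.connected.exists_walk_length_eq_dist b r
  have h1 := ha.dist_eq hT
  have h2 := hb.dist_eq hT
  rw [T.dist_comm (u := r) (v := i), T.dist_comm (u := r)] at h1 h2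
  have pa : (SimpleGraph.Walk.cons ha.1 wa).IsPath :=
    SimpleGraph.Walk.isPath_of_length_eq_dist _ (by simp [hwa, h1])
  have pb : (SimpleGraph.Walk.cons hb.1 wb).IsPath :=
    SimpleGraph.Walk.isPath_of_length_eq_dist _ (by simp [hwb, h2])
  have := (hT.isAcyclic.subsingleton_path _ _).elim ⟨_, pa⟩ ⟨_, pb⟩
  have h3 := congrArg (fun x => x.1.snd) this
  simpa using h3

theorem exists_isParentMap (r : Fin n) {T : SimpleGraph (Fin n)} (hT : T.IsTree) :
    ∃ p, IsParentMap r T p := by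
  have key : ∀ i, ∃ j, (i = r → j = r) ∧ (i ≠ r → GlobalArc r T i j) := by
    intro i
    by_cases hi : i = r
    · exact ⟨r, fun _ => rfl, fun h => absurd hi h⟩
    · obtain ⟨w, hw⟩ := hT.connected.exists_walk_length_eq_dist i r
      cases w with
      | nil => exact absurd rfl hi
      | @cons _ j _ h w' =>
        refine ⟨j, fun h => absurd h hi, fun _ => ⟨h, ?_⟩⟩
        have h1 := SimpleGraph.dist_le w'
        rw [T.dist_comm, T.dist_comm (u := r), ← hw, SimpleGraph.Walk.length_cons]
        omega
  choose p hp using key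
  refine ⟨p, hT, (hp r).1 rfl, fun i j => ⟨fun h => ?_, ?_⟩⟩
  · have hi : i ≠ r := by
      rintro rfl
      have := h.2
      simp at this
    exact ⟨hi, ((hp i).2 hi).parent_unique hT h⟩
  · rintro ⟨hi, rfl⟩
    exact (hp i).2 hi

namespace IsParentMap

variable {r : Fin n} {T : SimpleGraph (Fin n)} {p : Fin n → Fin n}

theorem globalArc (hp : IsParentMap r T p) {i : Fin n} (hi : i ≠ r) : GlobalArc r T i (p i) :=
  (hp.globalArc_iff i _).2 ⟨hi, rfl⟩

theorem dist_eq (hp : IsParentMap r T p) {i : Fin n} (hi : i ≠ r) :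
    T.dist r i = T.dist r (p i) + 1 :=
  (hp.globalArc hi).dist_eq hp.isTree

theorem map_ne (hp : IsParentMap r T p) {i : Fin n} (hi : i ≠ r) : p i ≠ i := by
  intro h
  have := hp.dist_eq hi
  rw [h] at this
  omega

theorem adj_iff (hp : IsParentMap r T p) {i j : Fin n} :
    T.Adj i j ↔ (i ≠ r ∧ p i = j) ∨ (j ≠ r ∧ p j = i) := by
  rw [← hp.globalArc_iff, ← hp.globalArc_iff]
  constructor
  · intro h
    rcases lt_or_gt_of_ne (hp.isTree.dist_ne_of_adj r h) with h1 | h1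
    · exact Or.inr ⟨h.symm, h1⟩
    · exact Or.inl ⟨h, h1⟩
  · rintro (h | h)
    · exact h.1
    · exact h.1.symm

theorem graph_ext {T' : SimpleGraph (Fin n)} (hp : IsParentMap r T p)
    (hp' : IsParentMap r T' p) : T = T' := by
  ext i j
  rw [hp.adj_iff, hp'.adj_iff]

/-- Induction along the paths towards the root. -/
theorem induction (hp : IsParentMap r T p) {P : Fin n → Prop} (root : P r)
    (step : ∀ i, i ≠ r → P (p i) → P i) (i : Fin n) : P i := by
  induction hd : T.dist r i generalizing i with
  | zero =>
    have h := (hp.isTree.connected.dist_eq_zero_iff).1 hd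
    exact h ▸ root
  | succ d ih =>
    by_cases hi : i = r
    · exact hi ▸ root
    · refine step i hi (ih _ ?_)
      have := hp.dist_eq hi
      omega

end IsParentMap

/-- The graph whose edges join every `i ≠ r` to `f i`. -/
def graphOfMap (r : Fin n) (f : Fin n → Fin n) : SimpleGraph (Fin n) :=
  SimpleGraph.fromRel fun i j => i ≠ r ∧ f i = j

theorem isParentMap_graphOfMap {r : Fin n} {f : Fin n → Fin n} (hr : f r = r)
    (hf : ∀ i, ∃ k, f^[k] i = r) : IsParentMap r (graphOfMap r f) f := by
  classical
  have hne : ∀ i, i ≠ r → f i ≠ i := by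
    intro i hi h
    obtain ⟨k, hk⟩ := hf i
    rw [Function.iterate_fixed h] at hk
    exact hi hk
  have hadj : ∀ i j, (graphOfMap r f).Adj i j ↔ (i ≠ r ∧ f i = j) ∨ (j ≠ r ∧ f j = i) := by
    intro i j
    rw [graphOfMap, SimpleGraph.fromRel_adj]
    refine ⟨fun h => h.2, fun h => ⟨?_, h⟩⟩
    rintro rfl
    rcases h with h | h <;> exact hne _ h.1 h.2
  have hadj' : ∀ i, i ≠ r → (graphOfMap r f).Adj i (f i) :=
    fun i hi => (hadj i _).2 (Or.inl ⟨hi, rfl⟩)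
  -- The number of applications of `f` needed to reach `r`. It changes by one along each edge, so it
  -- is the distance to `r`.
  set d : Fin n → ℕ := fun i => Nat.find (hf i) with hd
  have hdr : d r = 0 := (Nat.find_eq_zero (hf r)).2 rfl
  have hds : ∀ i, i ≠ r → d i = d (f i) + 1 := by
    intro i hi
    exact Nat.find_comp_succ (hf i) (hf (f i)) hi
  have hreach : ∀ k i, d i = k → ∃ w : (graphOfMap r f).Walk r i, w.length = k := by
    intro k
    induction k with
    | zero =>
      intro i hi
      have : i = r := by simpa [hd] using hi
      subst this
      exact ⟨.nil, rfl⟩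
    | succ k ih =>
      intro i hi
      have hir : i ≠ r := by
        rintro rfl
        omega
      obtain ⟨w, hw⟩ := ih (f i) (by have := hds i hir; omega)
      exact ⟨w.concat (hadj' i hir).symm, by simp [hw]⟩
  have hlen : ∀ i j (w : (graphOfMap r f).Walk i j), d j ≤ d i + w.length := by
    intro i j w
    induction w with
    | nil => simp
    | @cons a b c h w ih =>
      rw [SimpleGraph.Walk.length_cons]
      rcases (hadj a b).1 h with ⟨h1, h2⟩ | ⟨h1, h2⟩
      · have := hds a h1
        rw [h2] at this
        omega
      · have := hds b h1
        rw [h2] at this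
        omega
  have hconn : (graphOfMap r f).Connected := by
    have : Nonempty (Fin n) := ⟨r⟩
    refine SimpleGraph.Connected.mk fun i j => ?_
    obtain ⟨w, -⟩ := hreach _ i rfl
    obtain ⟨w', -⟩ := hreach _ j rfl
    exact ⟨w.reverse.append w'⟩
  have hdist : ∀ i, (graphOfMap r f).dist r i = d i := by
    intro i
    obtain ⟨w, hw⟩ := hreach _ i rfl
    obtain ⟨w', hw'⟩ := hconn.exists_walk_length_eq_dist r i
    have h1 := SimpleGraph.dist_le w
    have h2 := hlen _ _ w'
    omega
  have htree : (graphOfMap r f).IsTree := by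
    rw [SimpleGraph.isTree_iff_connected_and_card]
    refine ⟨hconn, le_antisymm ?_ hconn.card_vert_le_card_edgeSet_add_one⟩
    -- Each edge comes from one of the `n - 1` vertices `i ≠ r`; a connected graph with so few edges
    -- is a tree.
    have hsub : (graphOfMap r f).edgeSet ⊆
        ((Finset.univ.erase r).image fun i => s(i, f i) : Finset (Sym2 (Fin n))) := by
      intro e
      induction e with
      | _ i j =>
        rw [SimpleGraph.mem_edgeSet, hadj]
        simp only [Finset.coe_image, Set.mem_image, Finset.mem_coe, Finset.mem_erase,
          Finset.mem_univ, and_true]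
        rintro (⟨h, rfl⟩ | ⟨h, rfl⟩)
        · exact ⟨i, h, rfl⟩
        · exact ⟨j, h, Sym2.eq_swap⟩
    have h1 := Set.ncard_le_ncard hsub (Finset.finite_toSet _)
    rw [Set.ncard_coe_finset] at h1
    have h2 := h1.trans Finset.card_image_le
    rw [Finset.card_erase_of_mem (Finset.mem_univ r)] at h2
    have h3 : 0 < n := r.pos
    simp only [Finset.card_univ, Fintype.card_fin] at h2
    rw [Nat.card_coe_set_eq, Nat.card_eq_fintype_card, Fintype.card_fin]
    omega
  refine ⟨htree, hr, fun i j => ?_⟩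
  unfold GlobalArc
  rw [hadj, hdist, hdist]
  constructor
  · rintro ⟨h | h, h'⟩
    · exact h
    · have := hds j h.1
      rw [h.2] at this
      omega
  · rintro ⟨h1, rfl⟩
    exact ⟨Or.inl ⟨h1, rfl⟩, by have := hds i h1; omega⟩

/-! ### Increasing trees and the permutation `σ` -/

/-- The root of the increasing tree that contains `v`. -/
def incRoot (r : Fin n) (p : Fin n → Fin n) (v : Fin n) : Fin n :=
  if v ≠ r ∧ p v < v then incRoot r p (p v) else v
termination_by v
decreasing_by
  rename_i h
  exact h.2

section incRoot

variable {r : Fin n} {p : Fin n → Fin n} {v : Fin n}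

theorem incRoot_of_lt (h : v ≠ r ∧ p v < v) : incRoot r p v = incRoot r p (p v) := by
  rw [incRoot, if_pos h]

theorem incRoot_of_not_lt (h : ¬ (v ≠ r ∧ p v < v)) : incRoot r p v = v := by
  rw [incRoot, if_neg h]

theorem incRoot_le (r : Fin n) (p : Fin n → Fin n) (v : Fin n) : incRoot r p v ≤ v := by
  induction v using WellFoundedLT.induction with
  | ind v ih =>
    by_cases h : v ≠ r ∧ p v < v
    · rw [incRoot_of_lt h]
      exact (ih _ h.2).trans h.2.le
    · rw [incRoot_of_not_lt h]

theorem incRoot_lt (h : v ≠ r ∧ p v < v) : incRoot r p v < v := by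
  rw [incRoot_of_lt h]
  exact (incRoot_le r p _).trans_lt h.2

theorem not_lt_incRoot (r : Fin n) (p : Fin n → Fin n) (v : Fin n) :
    ¬ (incRoot r p v ≠ r ∧ p (incRoot r p v) < incRoot r p v) := by
  induction v using WellFoundedLT.induction with
  | ind v ih =>
    by_cases h : v ≠ r ∧ p v < v
    · rw [incRoot_of_lt h]
      exact ih _ h.2
    · rwa [incRoot_of_not_lt h]

theorem incRoot_incRoot (r : Fin n) (p : Fin n → Fin n) (v : Fin n) :
    incRoot r p (incRoot r p v) = incRoot r p v :=
  incRoot_of_not_lt (not_lt_incRoot r p v)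

end incRoot

/-! ### Cycles given by lists -/

section formPerm

variable {α : Type*} [DecidableEq α]

theorem formPerm_apply_of_append {A C : List α} {x y : α} (h : (A ++ x :: y :: C).Nodup) :
    (A ++ x :: y :: C).formPerm x = y := by
  have := List.formPerm_apply_lt_getElem _ h A.length (by simp)
  simpa using this

theorem formPerm_iterate_of_append {A B C : List α} {x y : α}
    (h : (A ++ x :: (B ++ y :: C)).Nodup) :
    (A ++ x :: (B ++ y :: C)).formPerm^[B.length + 1] x = y ∧
      ∀ j < B.length, (A ++ x :: (B ++ y :: C)).formPerm^[j + 1] x ∈ B := by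
  induction B generalizing A x with
  | nil => simpa using formPerm_apply_of_append h
  | cons b B ih =>
    have h1 : (A ++ x :: (b :: B ++ y :: C)).formPerm x = b := formPerm_apply_of_append h
    have h2 : A ++ x :: (b :: B ++ y :: C) = (A ++ [x]) ++ b :: (B ++ y :: C) := by simp
    obtain ⟨h3, h4⟩ := ih (A := A ++ [x]) (x := b) (h2 ▸ h)
    rw [← h2] at h3 h4
    refine ⟨by rw [List.length_cons, Function.iterate_succ_apply, h1, h3], fun j hj => ?_⟩
    rw [Function.iterate_succ_apply, h1]
    cases j with
    | zero => simp
    | succ j => exact List.mem_cons_of_mem _ (h4 j (by simpa using hj))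

/-- Only the cycle through `x` moves `x` or its image; all the other factors fix both. -/
theorem prod_formPerm_apply {ι : Type*} (L : ι → List α) {hs : List ι}
    (hd : hs.Pairwise fun a b => (L a).Disjoint (L b)) {h : ι} (hh : h ∈ hs) {x : α}
    (hx : x ∈ L h) : (hs.map fun a => (L a).formPerm).prod x = (L h).formPerm x := by
  have hfix : ∀ (hs : List ι) (x : α), (∀ a ∈ hs, x ∉ L a) →
      (hs.map fun a => (L a).formPerm).prod x = x := by
    intro hs
    induction hs with
    | nil => simp
    | cons a hs ih =>
      intro x hx
      rw [List.map_cons, List.prod_cons, Equiv.Perm.mul_apply,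
        ih x fun b hb => hx b (List.mem_cons_of_mem _ hb),
        List.formPerm_apply_of_notMem (hx a List.mem_cons_self)]
  induction hs with
  | nil => simp at hh
  | cons a hs ih =>
    rw [List.pairwise_cons] at hd
    rw [List.map_cons, List.prod_cons, Equiv.Perm.mul_apply]
    rcases List.mem_cons.1 hh with rfl | hh
    · rw [hfix hs x fun b hb hxb => hd.1 b hb hx hxb]
    · rw [ih hd.2 hh]
      refine List.formPerm_apply_of_notMem fun h1 => hd.1 h hh h1 ?_
      exact List.formPerm_apply_mem_of_mem hx

end formPerm

/-! ### Postorder in an increasing tree -/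

theorem postorder_eq (r : Fin n) (T : SimpleGraph (Fin n)) (v : Fin n) :
    postorder r T v =
      ((badChildren r T v).sort (· ≤ ·)).flatMap (postorder r T) ++ [v] := by
  rw [postorder]
  congr 1
  rw [List.flatMap_subtype (g := postorder r T) (fun _ _ => rfl), List.unattach_attach]

namespace IsParentMap

variable {r : Fin n} {T : SimpleGraph (Fin n)} {p : Fin n → Fin n}

theorem badArc_iff (hp : IsParentMap r T p) {i j : Fin n} :
    BadArc r T i j ↔ i ≠ r ∧ p i = j ∧ j < i := by
  unfold BadArc LocalArc
  rw [hp.globalArc_iff, hp.adj_iff]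
  tauto

theorem goodArc_iff (hp : IsParentMap r T p) {i j : Fin n} :
    GoodArc r T i j ↔ i ≠ r ∧ p i = j ∧ i < j := by
  unfold GoodArc LocalArc
  rw [hp.globalArc_iff, hp.adj_iff]
  tauto

theorem mem_badChildren (hp : IsParentMap r T p) {c v : Fin n} :
    c ∈ badChildren r T v ↔ c ≠ r ∧ p c = v ∧ v < c := by
  simp [badChildren, hp.badArc_iff]

theorem mem_increasingRoots (hp : IsParentMap r T p) {v : Fin n} :
    v ∈ increasingRoots r T ↔ ¬ (v ≠ r ∧ p v < v) := by
  simp [increasingRoots, hp.badArc_iff]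

theorem mem_postorder_iff_child (hp : IsParentMap r T p) {v w : Fin n} :
    w ∈ postorder r T v ↔ w = v ∨ ∃ c, (c ≠ r ∧ p c = v ∧ v < c) ∧ w ∈ postorder r T c := by
  rw [postorder_eq]
  simp [hp.mem_badChildren, or_comm]

theorem self_mem_postorder (r : Fin n) (T : SimpleGraph (Fin n)) (v : Fin n) :
    v ∈ postorder r T v := by
  rw [postorder_eq]
  simp

/-- The recursion defining `postorder` descends from `v` to children; this form climbs from `w` to
its parent, which allows induction on the member `w`. -/
theorem mem_postorder_iff (hp : IsParentMap r T p) {v w : Fin n} :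
    w ∈ postorder r T v ↔ w = v ∨ ((w ≠ r ∧ p w < w) ∧ p w ∈ postorder r T v) := by
  induction v using WellFoundedGT.induction with
  | ind v ih =>
    rw [hp.mem_postorder_iff_child]
    refine or_congr_right ⟨?_, ?_⟩
    · rintro ⟨c, hc, hw⟩
      rcases (ih c hc.2.2).1 hw with rfl | ⟨h1, h2⟩
      · refine ⟨⟨hc.1, by rw [hc.2.1]; exact hc.2.2⟩, ?_⟩
        rw [hc.2.1]
        exact self_mem_postorder r T v
      · exact ⟨h1, hp.mem_postorder_iff_child.2 (Or.inr ⟨c, hc, h2⟩)⟩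
    · rintro ⟨h1, h2⟩
      rcases hp.mem_postorder_iff_child.1 h2 with h3 | ⟨c, hc, h3⟩
      · exact ⟨w, ⟨h1.1, h3, h3 ▸ h1.2⟩, self_mem_postorder r T w⟩
      · exact ⟨c, hc, (ih c hc.2.2).2 (Or.inr ⟨h1, h3⟩)⟩

theorem le_of_mem_postorder (hp : IsParentMap r T p) {v w : Fin n} (h : w ∈ postorder r T v) :
    v ≤ w := by
  induction w using WellFoundedLT.induction with
  | ind w ih =>
    rcases hp.mem_postorder_iff.1 h with rfl | ⟨h1, h2⟩
    · exact le_rfl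
    · exact (ih _ h1.2 h2).trans h1.2.le

theorem incRoot_of_mem_postorder (hp : IsParentMap r T p) {v w : Fin n}
    (h : w ∈ postorder r T v) : incRoot r p w = incRoot r p v := by
  induction w using WellFoundedLT.induction with
  | ind w ih =>
    rcases hp.mem_postorder_iff.1 h with rfl | ⟨h1, h2⟩
    · rfl
    · rw [incRoot_of_lt h1, ih _ h1.2 h2]

theorem mem_postorder_incRoot (hp : IsParentMap r T p) (v : Fin n) :
    v ∈ postorder r T (incRoot r p v) := by
  induction v using WellFoundedLT.induction with
  | ind v ih =>
    by_cases h : v ≠ r ∧ p v < v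
    · rw [incRoot_of_lt h]
      exact hp.mem_postorder_iff.2 (Or.inr ⟨h, ih _ h.2⟩)
    · rw [incRoot_of_not_lt h]
      exact self_mem_postorder r T v

theorem mem_postorder_of_mem_increasingRoots (hp : IsParentMap r T p) {h w : Fin n}
    (hh : h ∈ increasingRoots r T) : w ∈ postorder r T h ↔ incRoot r p w = h := by
  rw [hp.mem_increasingRoots] at hh
  constructor
  · intro hw
    rw [hp.incRoot_of_mem_postorder hw, incRoot_of_not_lt hh]
  · rintro rfl
    exact hp.mem_postorder_incRoot w

theorem mem_postorder_or_mem_postorder (hp : IsParentMap r T p) {a b w : Fin n}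
    (ha : w ∈ postorder r T a) (hb : w ∈ postorder r T b) :
    a ∈ postorder r T b ∨ b ∈ postorder r T a := by
  induction w using WellFoundedLT.induction with
  | ind w ih =>
    rcases hp.mem_postorder_iff.1 ha with rfl | ⟨h1, h2⟩
    · exact Or.inl hb
    rcases hp.mem_postorder_iff.1 hb with rfl | ⟨-, h3⟩
    · exact Or.inr ha
    exact ih _ h1.2 h2 h3

theorem nodup_postorder (hp : IsParentMap r T p) (v : Fin n) : (postorder r T v).Nodup := by
  induction v using WellFoundedGT.induction with
  | ind v ih =>
    -- A sibling `a ≠ b` in the subtree of `b` would put the common parent `v` there too, although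
    -- `v < b`.
    have hsep : ∀ a b, a ∈ badChildren r T v → b ∈ badChildren r T v →
        a ∈ postorder r T b → a = b := by
      intro a b ha hb h
      rw [hp.mem_badChildren] at ha hb
      rcases hp.mem_postorder_iff.1 h with h1 | ⟨-, h1⟩
      · exact h1
      · rw [ha.2.1] at h1
        exact absurd (hp.le_of_mem_postorder h1) hb.2.2.not_ge
    rw [postorder_eq, List.nodup_append, List.nodup_flatMap]
    refine ⟨⟨fun c hc => ih c (hp.mem_badChildren.1 ((Finset.mem_sort _).1 hc)).2.2, ?_⟩,
      List.nodup_singleton v, ?_⟩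
    · refine List.Pairwise.imp_of_mem ?_ (Finset.sort_nodup (badChildren r T v) (· ≤ ·))
      intro a b ha hb hab w hwa hwb
      rw [Finset.mem_sort] at ha hb
      rcases hp.mem_postorder_or_mem_postorder hwa hwb with h | h
      · exact hab (hsep a b ha hb h)
      · exact hab (hsep b a hb ha h).symm
    · intro a ha b hb
      rw [List.mem_singleton] at hb
      rw [List.mem_flatMap] at ha
      obtain ⟨c, hc, ha⟩ := ha
      have h1 := (hp.mem_badChildren.1 ((Finset.mem_sort _).1 hc)).2.2
      have h2 := hp.le_of_mem_postorder ha
      subst hb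
      exact (h1.trans_le h2).ne'

/-- After `w` come the subtrees of its larger siblings, then its parent. Labels increase away from
the root, so everything in between exceeds `w`. -/
theorem postorder_eq_append (hp : IsParentMap r T p) {v w : Fin n} (hw : w ∈ postorder r T v)
    (hwv : w ≠ v) :
    ∃ A B C, postorder r T v = A ++ w :: (B ++ p w :: C) ∧ ∀ x ∈ B, w < x := by
  induction v using WellFoundedGT.induction with
  | ind v ih =>
    rcases hp.mem_postorder_iff_child.1 hw with h | ⟨c, hc, hwc⟩
    · exact absurd h hwv
    obtain ⟨X, Y, hXY⟩ :=
      List.append_of_mem ((Finset.mem_sort (· ≤ ·)).2 (hp.mem_badChildren.2 hc))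
    have hpost : postorder r T v =
        X.flatMap (postorder r T) ++ postorder r T c ++ Y.flatMap (postorder r T) ++ [v] := by
      rw [postorder_eq, hXY]
      simp
    by_cases hcw : w = c
    · subst hcw
      refine ⟨X.flatMap (postorder r T) ++
        ((badChildren r T w).sort (· ≤ ·)).flatMap (postorder r T),
        Y.flatMap (postorder r T), [], ?_, ?_⟩
      · rw [hpost, postorder_eq r T w, hc.2.1]
        simp
      · intro x hx
        obtain ⟨y, hy, hx⟩ := List.mem_flatMap.1 hx
        have hs := Finset.sortedLT_sort (badChildren r T v)
        have hs' := hs.pairwise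
        rw [hXY, List.pairwise_append, List.pairwise_cons] at hs'
        exact (hs'.2.1.1 y hy).trans_le (hp.le_of_mem_postorder hx)
    · obtain ⟨A, B, C, h1, h2⟩ := ih c hc.2.2 hwc hcw
      refine ⟨X.flatMap (postorder r T) ++ A, B, C ++ Y.flatMap (postorder r T) ++ [v], ?_, h2⟩
      rw [hpost, h1]
      simp

theorem sigma_apply (hp : IsParentMap r T p) (v : Fin n) :
    sigma r T v = (postorder r T (incRoot r p v)).formPerm v := by
  unfold sigma
  refine prod_formPerm_apply (postorder r T) ?_ ?_ (hp.mem_postorder_incRoot v)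
  · refine List.Pairwise.imp_of_mem ?_ (Finset.sort_nodup (increasingRoots r T) (· ≤ ·))
    intro a b ha hb hab w hwa hwb
    rw [Finset.mem_sort] at ha hb
    rw [hp.mem_postorder_of_mem_increasingRoots ha] at hwa
    rw [hp.mem_postorder_of_mem_increasingRoots hb] at hwb
    exact hab (hwa.symm.trans hwb)
  · rw [Finset.mem_sort, hp.mem_increasingRoots]
    exact not_lt_incRoot r p v

theorem incRoot_sigma (hp : IsParentMap r T p) (v : Fin n) :
    incRoot r p (sigma r T v) = incRoot r p v := by
  rw [hp.sigma_apply, hp.incRoot_of_mem_postorder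
    (List.formPerm_apply_mem_of_mem (hp.mem_postorder_incRoot v)), incRoot_incRoot]

theorem sigma_iterate_eq_formPerm (hp : IsParentMap r T p) (v : Fin n) (k : ℕ) :
    (sigma r T)^[k] v = (postorder r T (incRoot r p v)).formPerm^[k] v ∧
      incRoot r p ((sigma r T)^[k] v) = incRoot r p v := by
  induction k with
  | zero => exact ⟨rfl, rfl⟩
  | succ k ih =>
    rw [Function.iterate_succ_apply', Function.iterate_succ_apply', hp.incRoot_sigma]
    refine ⟨?_, ih.2⟩
    rw [hp.sigma_apply, ih.2, ih.1]

/-- The parent of `v` in an increasing tree is the first vertex smaller than `v` that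
follows `v` in postorder. -/
theorem exists_sigma_iterate_eq (hp : IsParentMap r T p) {v : Fin n} (hv : v ≠ r ∧ p v < v) :
    ∃ k, (sigma r T)^[k + 1] v = p v ∧ ∀ j < k, v < (sigma r T)^[j + 1] v := by
  obtain ⟨A, B, C, h1, h2⟩ := hp.postorder_eq_append (hp.mem_postorder_incRoot v)
    (incRoot_lt hv).ne'
  have hnd := hp.nodup_postorder (incRoot r p v)
  rw [h1] at hnd
  obtain ⟨h3, h4⟩ := formPerm_iterate_of_append hnd
  rw [← h1] at h3 h4
  refine ⟨B.length, ?_, fun j hj => ?_⟩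
  · rw [(hp.sigma_iterate_eq_formPerm v _).1, h3]
  · rw [(hp.sigma_iterate_eq_formPerm v _).1]
    exact h2 _ (h4 j hj)

theorem exists_sigma_iterate_eq_incRoot (hp : IsParentMap r T p) (v : Fin n) :
    ∃ k, (sigma r T)^[k] v = incRoot r p v := by
  induction v using WellFoundedLT.induction with
  | ind v ih =>
    by_cases h : v ≠ r ∧ p v < v
    · obtain ⟨k, hk⟩ := ih _ h.2
      obtain ⟨l, hl, -⟩ := hp.exists_sigma_iterate_eq h
      refine ⟨k + (l + 1), ?_⟩
      rw [Function.iterate_add_apply, hl, hk, incRoot_of_lt h]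
    · exact ⟨0, (incRoot_of_not_lt h).symm⟩

theorem exists_infix_postorder_iff (hp : IsParentMap r T p) {i k : Fin n} :
    (∃ h ∈ increasingRoots r T, [i, k] <:+: postorder r T h) ↔
      (i ≠ r ∧ p i < i) ∧ sigma r T i = k := by
  constructor
  · rintro ⟨h, hh, A, C, hAC⟩
    have hnd := hp.nodup_postorder h
    have hi : incRoot r p i = h := by
      rw [← hp.mem_postorder_of_mem_increasingRoots hh, ← hAC]
      simp
    refine ⟨?_, ?_⟩
    -- The root of an increasing tree ends its postorder; if `k` followed it, it would also occur
    -- before the end, against `Nodup`.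
    · by_contra hcon
      rw [incRoot_of_not_lt hcon] at hi
      subst hi
      rw [postorder_eq] at hAC hnd
      rw [List.nodup_append] at hnd
      have h1 : (A ++ [i]) ++ (k :: C).dropLast ++ [(k :: C).getLast (by simp)] =
          ((badChildren r T i).sort (· ≤ ·)).flatMap (postorder r T) ++ [i] := by
        rw [← hAC, List.append_assoc, List.dropLast_append_getLast]
        simp
      have h2 := (List.append_inj' h1 rfl).1
      refine hnd.2.2 i ?_ i (by simp) rfl
      rw [← h2]
      simp
    · rw [hp.sigma_apply, hi]
      have h1 : postorder r T h = A ++ i :: k :: C := by rw [← hAC]; simp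
      rw [h1] at hnd ⊢
      exact formPerm_apply_of_append hnd
  · rintro ⟨hi, rfl⟩
    refine ⟨incRoot r p i, hp.mem_increasingRoots.2 (not_lt_incRoot r p i), ?_⟩
    obtain ⟨A, B, C, h1, -⟩ := hp.postorder_eq_append (hp.mem_postorder_incRoot i)
      (incRoot_lt hi).ne'
    have hnd := hp.nodup_postorder (incRoot r p i)
    obtain ⟨y, D, hy⟩ : ∃ y D, B ++ p i :: C = y :: D := by
      cases B with
      | nil => exact ⟨_, _, rfl⟩
      | cons b B => exact ⟨_, _, rfl⟩
    rw [hy] at h1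
    rw [hp.sigma_apply]
    rw [h1] at hnd ⊢
    rw [formPerm_apply_of_append hnd]
    exact ⟨A, D, by simp⟩

theorem phiArc_iff (hp : IsParentMap r T p) {i k : Fin n} :
    PhiArc r T i k ↔ i ≠ r ∧ sigma r T (max i (p i)) = k := by
  unfold PhiArc
  rw [hp.exists_infix_postorder_iff]
  simp only [hp.goodArc_iff]
  constructor
  · rintro (⟨⟨h1, h2⟩, h3⟩ | ⟨j, ⟨h1, rfl, h2⟩, h3⟩)
    · exact ⟨h1, by rwa [max_eq_left h2.le]⟩
    · exact ⟨h1, by rw [max_eq_right h2.le, h3]⟩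
  · rintro ⟨h1, rfl⟩
    rcases lt_or_gt_of_ne (hp.map_ne h1) with h2 | h2
    · exact Or.inl ⟨⟨h1, h2⟩, by rw [max_eq_left h2.le]⟩
    · exact Or.inr ⟨p i, ⟨h1, rfl, h2⟩, by rw [max_eq_right h2.le]⟩

end IsParentMap

/-! ### The map `Φ` -/

/-- The parent map of `Phi r T`, if `p` is the parent map of `T`. -/
noncomputable def phiMap (r : Fin n) (T : SimpleGraph (Fin n)) (p : Fin n → Fin n)
    (i : Fin n) : Fin n :=
  if i = r then r else sigma r T (max i (p i))

theorem phiMap_of_ne {r : Fin n} {T : SimpleGraph (Fin n)} {p : Fin n → Fin n} {i : Fin n}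
    (hi : i ≠ r) : phiMap r T p i = sigma r T (max i (p i)) :=
  if_neg hi

namespace IsParentMap

variable {r : Fin n} {T : SimpleGraph (Fin n)} {p : Fin n → Fin n}

theorem phi_eq_graphOfMap (hp : IsParentMap r T p) :
    Phi r T = graphOfMap r (phiMap r T p) := by
  unfold Phi graphOfMap
  congr 1
  funext i k
  rw [hp.phiArc_iff, eq_iff_iff]
  exact and_congr_right fun hi => by rw [phiMap_of_ne hi]

theorem phiMap_of_lt {v : Fin n} (hv : v ≠ r ∧ p v < v) : phiMap r T p v = sigma r T v := by
  rw [phiMap_of_ne hv.1, max_eq_left hv.2.le]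

theorem incRoot_phiMap (hp : IsParentMap r T p) {v : Fin n} (hv : v ≠ r) :
    incRoot r p (phiMap r T p v) = incRoot r p (max v (p v)) := by
  rw [phiMap_of_ne hv, hp.incRoot_sigma]

theorem exists_phiMap_iterate_eq_incRoot (hp : IsParentMap r T p) (v : Fin n) :
    ∃ k, (phiMap r T p)^[k] v = incRoot r p v := by
  obtain ⟨k, hk⟩ := hp.exists_sigma_iterate_eq_incRoot v
  induction k generalizing v with
  | zero => exact ⟨0, hk⟩
  | succ k ih =>
    by_cases hv : v ≠ r ∧ p v < v
    · rw [Function.iterate_succ_apply, ← hp.incRoot_sigma] at hk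
      obtain ⟨l, hl⟩ := ih _ hk
      refine ⟨l + 1, ?_⟩
      rw [Function.iterate_succ_apply, phiMap_of_lt hv, hl, hp.incRoot_sigma]
    · exact ⟨0, (incRoot_of_not_lt hv).symm⟩

theorem dist_incRoot_le (hp : IsParentMap r T p) (v : Fin n) :
    T.dist r (incRoot r p v) ≤ T.dist r v := by
  induction v using WellFoundedLT.induction with
  | ind v ih =>
    by_cases h : v ≠ r ∧ p v < v
    · rw [incRoot_of_lt h, hp.dist_eq h.1]
      exact (ih _ h.2).trans (Nat.le_succ _)
    · rw [incRoot_of_not_lt h]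

theorem exists_phiMap_iterate_eq (hp : IsParentMap r T p) (v : Fin n) :
    ∃ k, (phiMap r T p)^[k] v = r := by
  induction hd : T.dist r (incRoot r p v) using Nat.strong_induction_on generalizing v with
  | _ d ih =>
    obtain ⟨k, hk⟩ := hp.exists_phiMap_iterate_eq_incRoot v
    by_cases hr : incRoot r p v = r
    · exact ⟨k, hk.trans hr⟩
    have h1 := not_lt_incRoot r p v
    generalize incRoot r p v = h at *
    -- The edge above `h` is good, so the next step leads into the increasing tree of `p h`, whose
    -- root is at most as far from `r` as `p h`, hence closer than `h`.
    have h2 : h < p h := lt_of_le_of_ne (not_lt.1 fun h3 => h1 ⟨hr, h3⟩) (hp.map_ne hr).symm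
    have h3 := hp.incRoot_phiMap hr
    rw [max_eq_right h2.le] at h3
    have h4 := hp.dist_incRoot_le (p h)
    have h5 := hp.dist_eq hr
    obtain ⟨l, hl⟩ := ih _ (by rw [h3]; omega) (phiMap r T p h) rfl
    refine ⟨l + (1 + k), ?_⟩
    rw [Function.iterate_add_apply, Function.iterate_add_apply, hk]
    exact hl

theorem phi (hp : IsParentMap r T p) : IsParentMap r (Phi r T) (phiMap r T p) := by
  rw [hp.phi_eq_graphOfMap]
  exact isParentMap_graphOfMap (if_pos rfl) hp.exists_phiMap_iterate_eq

/-! ### Recovering a tree from its image under `Phi` -/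

theorem incRoot_phiMap_le (hp : IsParentMap r T p) {v : Fin n} (hv : v ≠ r) :
    incRoot r p (phiMap r T p v) ≤ max v (p v) := by
  rw [hp.incRoot_phiMap hv]
  exact incRoot_le r p _

theorem le_max_of_phiMap_eq {v w : Fin n} (hv : v ≠ r) (hw : w ≠ r)
    (h : phiMap r T p w = phiMap r T p v) : w ≤ max v (p v) := by
  rw [phiMap_of_ne hv, phiMap_of_ne hw, (sigma r T).injective.eq_iff] at h
  exact h ▸ le_max_left _ _

/-- With the upper bounds `incRoot_phiMap_le` and `le_max_of_phiMap_eq`, this identifies `max v (p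
v)` as the largest of the siblings of `v` in the image and the root of the increasing tree of its
new parent. -/
theorem max_eq_incRoot_or (hp : IsParentMap r T p) {v : Fin n} (hv : v ≠ r) :
    max v (p v) = incRoot r p (phiMap r T p v) ∨
      (max v (p v) ≠ r ∧ phiMap r T p (max v (p v)) = phiMap r T p v) := by
  by_cases h : max v (p v) ≠ r ∧ p (max v (p v)) < max v (p v)
  · exact Or.inr ⟨h.1, by rw [phiMap_of_lt h, phiMap_of_ne hv]⟩
  · exact Or.inl (by rw [hp.incRoot_phiMap hv, incRoot_of_not_lt h])

theorem lt_iff_max_eq (hp : IsParentMap r T p) {v : Fin n} (hv : v ≠ r) :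
    (v ≠ r ∧ p v < v) ↔ max v (p v) = v := by
  rw [max_eq_left_iff]
  exact ⟨fun h => h.2.le, fun h => ⟨hv, lt_of_le_of_ne h (hp.map_ne hv)⟩⟩

theorem incRoot_eq_ite (hp : IsParentMap r T p) {v : Fin n} (hv : v ≠ r) :
    incRoot r p v = if max v (p v) = v then incRoot r p (phiMap r T p v) else v := by
  split_ifs with h
  · rw [hp.incRoot_phiMap hv, h]
  · rw [incRoot_of_not_lt]
    rwa [hp.lt_iff_max_eq hv]

theorem exists_phiMap_iterate_eq_parent (hp : IsParentMap r T p) {v : Fin n}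
    (hv : v ≠ r ∧ p v < v) :
    ∃ k, (phiMap r T p)^[k + 1] v = p v ∧ ∀ j < k, v < (phiMap r T p)^[j + 1] v := by
  obtain ⟨k, h1, h2⟩ := hp.exists_sigma_iterate_eq hv
  have key : ∀ j ≤ k + 1, (phiMap r T p)^[j] v = (sigma r T)^[j] v := by
    intro j
    induction j with
    | zero => intro; rfl
    | succ j ih =>
      intro hj
      rw [Function.iterate_succ_apply', Function.iterate_succ_apply', ih (by omega)]
      refine phiMap_of_lt ?_
      cases j with
      | zero => exact hv
      | succ j =>
        -- The iterates before the parent exceed `v`, and the root of the increasing tree is below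
        -- `v`. So none of them is that root, and `phiMap` still acts as `sigma`.
        by_contra hcon
        have h3 := incRoot_of_not_lt hcon
        rw [(hp.sigma_iterate_eq_formPerm v _).2] at h3
        have h4 := h2 j (by omega)
        rw [← h3] at h4
        exact h4.not_gt (incRoot_lt hv)
  refine ⟨k, by rw [key _ le_rfl, h1], fun j hj => ?_⟩
  rw [key _ (by omega)]
  exact h2 j hj

theorem eq_of_phiMap_eq (hp : IsParentMap r T p) {T' : SimpleGraph (Fin n)}
    {p' : Fin n → Fin n} (hp' : IsParentMap r T' p')
    (hq : phiMap r T p = phiMap r T' p') : p = p' := by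
  -- Quantified over both trees so that it can be used again with their roles exchanged.
  have hmax_le : ∀ {T T' : SimpleGraph (Fin n)} {p p' : Fin n → Fin n},
      IsParentMap r T p → IsParentMap r T' p' → phiMap r T p = phiMap r T' p' →
      ∀ v, v ≠ r → incRoot r p (phiMap r T p v) = incRoot r p' (phiMap r T p v) →
        max v (p v) ≤ max v (p' v) := by
    intro T T' p p' hp hp' hq v hv he
    rcases hp.max_eq_incRoot_or hv with h | ⟨h1, h2⟩
    · rw [h, he, hq]
      exact hp'.incRoot_phiMap_le hv
    · rw [hq] at h2
      exact le_max_of_phiMap_eq hv h1 h2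
  have hmax : ∀ v, v ≠ r → incRoot r p (phiMap r T p v) = incRoot r p' (phiMap r T p v) →
      max v (p v) = max v (p' v) := fun v hv he =>
    le_antisymm (hmax_le hp hp' hq v hv he)
      (hmax_le hp' hp hq.symm v hv (by rw [← hq]; exact he.symm))
  have hinc : ∀ v, incRoot r p v = incRoot r p' v := by
    refine hp.phi.induction ?_ fun v hv he => ?_
    · rw [incRoot_of_not_lt (by simp), incRoot_of_not_lt (by simp)]
    · rw [hp.incRoot_eq_ite hv, hp'.incRoot_eq_ite hv, ← hmax v hv he, he, hq]
  funext v
  by_cases hv : v = r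
  · rw [hv, hp.map_root, hp'.map_root]
  have hm := hmax v hv (hinc _)
  by_cases hb : max v (p v) = v
  · have hlt := (hp.lt_iff_max_eq hv).2 hb
    have hlt' := (hp'.lt_iff_max_eq hv).2 (hm ▸ hb)
    obtain ⟨k, h1, h2⟩ := hp.exists_phiMap_iterate_eq_parent hlt
    obtain ⟨k', h1', h2'⟩ := hp'.exists_phiMap_iterate_eq_parent hlt'
    rw [← hq] at h1' h2'
    -- Both `k + 1` and `k' + 1` are the first time that the common map takes `v` below itself.
    rcases lt_trichotomy k k' with h | rfl | h
    · exact absurd (h1 ▸ h2' k h) hlt.2.not_gt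
    · exact h1.symm.trans h1'
    · exact absurd (h1' ▸ h2 k' h) hlt'.2.not_gt
  · have h1 := (max_choice v (p v)).resolve_left hb
    have h2 := (max_choice v (p' v)).resolve_left (hm ▸ hb)
    rw [← h1, ← h2, hm]

/-! ### Local sibships become child-groups -/

theorem mem_localSibship (hp : IsParentMap r T p) {k v : Fin n} :
    k ∈ localSibship r T v ↔ k ≠ r ∧ max k (p k) = v := by
  simp only [localSibship, Finset.mem_filter, Finset.mem_univ, true_and, LocalArc,
    hp.globalArc_iff, hp.adj_iff]
  constructor
  · rintro ⟨i, ⟨-, hlt⟩, ⟨rfl, h1, h2⟩ | ⟨rfl, h1, h2⟩⟩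
    · exact ⟨h1, by rw [h2, max_eq_right hlt.le]⟩
    · exact ⟨h1, by rw [h2, max_eq_left hlt.le]⟩
  · rintro ⟨hk, rfl⟩
    rcases lt_or_gt_of_ne (hp.map_ne hk) with h | h
    · rw [max_eq_left h.le]
      exact ⟨p k, ⟨Or.inr ⟨hk, rfl⟩, h⟩, Or.inr ⟨rfl, hk, rfl⟩⟩
    · rw [max_eq_right h.le]
      exact ⟨k, ⟨Or.inl ⟨hk, rfl⟩, h⟩, Or.inl ⟨rfl, hk, rfl⟩⟩

theorem mem_childGroup (hp : IsParentMap r T p) {k v : Fin n} :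
    k ∈ childGroup r T v ↔ k ≠ r ∧ p k = v := by
  simp [childGroup, hp.globalArc_iff]

theorem childGroup_phi (hp : IsParentMap r T p) (v : Fin n) :
    childGroup r (Phi r T) (sigma r T v) = localSibship r T v := by
  ext k
  rw [hp.phi.mem_childGroup, hp.mem_localSibship]
  refine and_congr_right fun hk => ?_
  rw [phiMap_of_ne hk, (sigma r T).injective.eq_iff]

theorem phiGlo_phi (hp : IsParentMap r T p) : phiGlo r (Phi r T) = phiLoc r T := by
  unfold phiGlo phiLoc
  congr 1
  ext B
  simp only [Finset.mem_image, Finset.mem_univ, true_and]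
  rw [(sigma r T).surjective.exists]
  simp only [hp.childGroup_phi]

end IsParentMap

theorem bijOn_phi (r : Fin n) :
    Set.BijOn (Phi r) {T : SimpleGraph (Fin n) | T.IsTree} {T | T.IsTree} := by
  have hmaps : Set.MapsTo (Phi r) {T : SimpleGraph (Fin n) | T.IsTree} {T | T.IsTree} := by
    intro T hT
    obtain ⟨p, hp⟩ := exists_isParentMap r hT
    exact hp.phi.isTree
  have hinj : Set.InjOn (Phi r) {T : SimpleGraph (Fin n) | T.IsTree} := by
    intro T hT T' hT' h
    obtain ⟨p, hp⟩ := exists_isParentMap r hT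
    obtain ⟨p', hp'⟩ := exists_isParentMap r hT'
    have hq : phiMap r T p = phiMap r T' p' := by
      funext i
      by_cases hi : i = r
      · rw [hi, hp.phi.map_root, hp'.phi.map_root]
      · have h1 := hp.phi.globalArc hi
        rw [h] at h1
        exact h1.parent_unique hp'.phi.isTree (hp'.phi.globalArc hi)
    exact hp.graph_ext (hp.eq_of_phiMap_eq hp' hq ▸ hp')
  refine ⟨hmaps, hinj, fun T hT => ?_⟩
  obtain ⟨T', hT', h⟩ := Set.surj_on_of_inj_on_of_ncard_le (fun T _ => Phi r T)
    (fun _ h => hmaps h) (fun _ _ h h' e => hinj h h' e) le_rfl (Set.toFinite _) T hT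
  exact ⟨T', hT', h.symm⟩

theorem bijOn_phi_sibship (r : Fin n) (P : Finset (Finset (Fin n))) :
    Set.BijOn (Phi r) (treesOfLocalSibship r P) (treesOfGlobalSibship r P) := by
  have h := bijOn_phi r
  have hphi : ∀ {T : SimpleGraph (Fin n)}, T.IsTree → phiGlo r (Phi r T) = phiLoc r T :=
    fun hT => (exists_isParentMap r hT).choose_spec.phiGlo_phi
  refine ⟨fun T hT => ⟨h.mapsTo hT.1, (hphi hT.1).trans hT.2⟩,
    h.injOn.mono fun T hT => hT.1, fun T hT => ?_⟩
  obtain ⟨T', h1, rfl⟩ := h.surjOn hT.1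
  exact ⟨T', ⟨h1, (hphi h1).symm.trans hT.2⟩, rfl⟩

/-! ### The paternity map `ψ` -/

/-- `Decodes r p P ps`: the assignment `p` of a parent to all the elements of the blocks of `P` is
the one that gives, one after the other, the entries of `ps` as parent to the largest remaining
block that contains none of the remaining entries. -/
inductive Decodes (r : Fin n) (p : Fin n → Fin n) :
    Finset (Finset (Fin n)) → List (Fin n) → Prop
  | nil : Decodes r p ∅ []
  | cons {P : Finset (Finset (Fin n))} {v : Fin n} {ps : List (Fin n)} {B : Finset (Fin n)}
      (hB : B ∈ P) (hne : B.Nonempty) (hdisj : ∀ x ∈ B, x ∉ v :: ps)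
      (hmax : ∀ B' ∈ P, (∀ x ∈ B', x ∉ v :: ps) → B'.max ≤ B.max)
      (hp : ∀ i ∈ B, p i = v) (hv : v ∉ ps) (hr : ps = [] → v = r)
      (h : Decodes r p (P.erase B) ps) : Decodes r p P (v :: ps)

/-- The nonempty child-groups of the restriction of the tree `T` rooted at `r` to `V`. -/
noncomputable def groupsOn (r : Fin n) (T : SimpleGraph (Fin n)) (V : Finset (Fin n)) :
    Finset (Finset (Fin n)) :=
  (Finset.univ.image fun v => childGroup r T v ∩ V).erase ∅

theorem groupsOn_univ (r : Fin n) (T : SimpleGraph (Fin n)) :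
    groupsOn r T Finset.univ = phiGlo r T := by
  simp [groupsOn, phiGlo]

theorem mem_groupsOn {r : Fin n} {T : SimpleGraph (Fin n)} {V B : Finset (Fin n)} :
    B ∈ groupsOn r T V ↔ B.Nonempty ∧ ∃ v, childGroup r T v ∩ V = B := by
  simp [groupsOn, Finset.nonempty_iff_ne_empty]

theorem eq_of_max_eq {α : Type*} [LinearOrder α] {B B' : Finset α} (hB : B.Nonempty)
    (hd : B ≠ B' → Disjoint B B') (h : B.max = B'.max) : B = B' := by
  by_contra hne
  obtain ⟨a, ha⟩ := Finset.max_of_nonempty hB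
  exact Finset.disjoint_left.1 (hd hne) (Finset.mem_of_max ha) (Finset.mem_of_max (h ▸ ha))

namespace Decodes

variable {r : Fin n} {p : Fin n → Fin n} {P : Finset (Finset (Fin n))} {ps : List (Fin n)}

theorem mem_iff (h : Decodes r p P ps) {v : Fin n} : v ∈ ps ↔ ∃ B ∈ P, ∃ i ∈ B, p i = v := by
  induction h with
  | nil => simp
  | @cons P w ps B hB hne hdisj hmax hp hv hr h ih =>
    rw [List.mem_cons, ih]
    constructor
    · rintro (rfl | ⟨C, hC, i, hi, hiv⟩)
      · obtain ⟨i, hi⟩ := hne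
        exact ⟨B, hB, i, hi, hp i hi⟩
      · exact ⟨C, Finset.mem_of_mem_erase hC, i, hi, hiv⟩
    · rintro ⟨C, hC, i, hi, rfl⟩
      by_cases hCB : C = B
      · exact Or.inl (hp i (hCB ▸ hi))
      · exact Or.inr ⟨C, Finset.mem_erase.2 ⟨hCB, hC⟩, i, hi, rfl⟩

theorem mem_kPerms (h : Decodes r p P ps) : ps ∈ kPerms r P.card := by
  induction h with
  | nil => exact ⟨rfl, List.nodup_nil, by simp⟩
  | @cons P w ps B hB hne hdisj hmax hp hv hr h ih =>
    obtain ⟨h1, h2, h3⟩ := ih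
    refine ⟨?_, List.nodup_cons.2 ⟨hv, h2⟩, ?_⟩
    · rw [List.length_cons, h1, Finset.card_erase_add_one hB]
    · cases ps with
      | nil => simpa using hr rfl
      | cons a ps => rwa [List.getLast?_cons_cons]

theorem congr (h : Decodes r p P ps) {p' : Fin n → Fin n}
    (hp : ∀ B ∈ P, ∀ i ∈ B, p' i = p i) : Decodes r p' P ps := by
  induction h with
  | nil => exact nil
  | @cons P w ps B hB hne hdisj hmax hpB hv hr h ih =>
    exact cons hB hne hdisj hmax (fun i hi => (hp B hB i hi).trans (hpB i hi)) hv hr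
      (ih fun C hC => hp C (Finset.mem_of_mem_erase hC))

theorem pairwiseDisjoint_erase {Q : Finset (Finset (Fin n))}
    (hP : (Q : Set (Finset (Fin n))).PairwiseDisjoint id) (B : Finset (Fin n)) :
    ((Q.erase B : Finset _) : Set (Finset (Fin n))).PairwiseDisjoint id :=
  hP.subset (Finset.coe_subset.2 (Finset.erase_subset _ _))

/-- Which block is taken at each stage depends only on `P` and `ps`: disjoint nonempty blocks have
distinct maxima. -/
theorem eq_parent {p' : Fin n → Fin n} (h : Decodes r p P ps) (h' : Decodes r p' P ps)
    (hP : (P : Set (Finset (Fin n))).PairwiseDisjoint id) : ∀ B ∈ P, ∀ i ∈ B, p i = p' i := by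
  induction h with
  | nil => simp
  | @cons P w ps B hB hne hdisj hmax hpB hv hr h ih =>
    cases h' with
    | @cons _ _ _ B' hB' hne' hdisj' hmax' hpB' hv' hr' h' =>
      obtain rfl : B = B' := eq_of_max_eq hne (hP hB hB')
        (le_antisymm (hmax' B hB hdisj) (hmax B' hB' hdisj'))
      intro C hC i hi
      by_cases hCB : C = B
      · rw [hpB i (hCB ▸ hi), hpB' i (hCB ▸ hi)]
      · exact ih h' (pairwiseDisjoint_erase hP B) C (Finset.mem_erase.2 ⟨hCB, hC⟩) i hi

/-- The set of remaining entries is the set of parents of the remaining blocks (`mem_iff`), so both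
lists make the same blocks eligible. -/
theorem eq_list {ps' : List (Fin n)} (h : Decodes r p P ps) (h' : Decodes r p P ps')
    (hP : (P : Set (Finset (Fin n))).PairwiseDisjoint id) : ps = ps' := by
  induction h generalizing ps' with
  | nil =>
    cases h' with
    | nil => rfl
    | cons hB => simp at hB
  | @cons P w ps B hB hne hdisj hmax hpB hv hr h ih =>
    have hmem := fun v => (cons hB hne hdisj hmax hpB hv hr h).mem_iff (v := v)
    cases h' with
    | nil => simp at hB
    | @cons _ w' ps' B' hB' hne' hdisj' hmax' hpB' hv' hr' h' =>
      have hmem' := fun v => (cons hB' hne' hdisj' hmax' hpB' hv' hr' h').mem_iff (v := v)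
      obtain rfl : B = B' := eq_of_max_eq hne (hP hB hB')
        (le_antisymm (hmax' B hB fun x hx hx' => hdisj x hx ((hmem _).2 ((hmem' _).1 hx')))
          (hmax B' hB' fun x hx hx' => hdisj' x hx ((hmem' _).2 ((hmem _).1 hx'))))
      obtain ⟨i, hi⟩ := hne
      rw [ih h' (pairwiseDisjoint_erase hP B), ← hpB i hi, ← hpB' i hi]

/-- Entries do not repeat, so distinct blocks get distinct parents; this makes the blocks exactly
the child-groups of the decoded tree. -/
theorem parent_eq_iff (h : Decodes r p P ps)
    {B C : Finset (Fin n)} (hB : B ∈ P) (hC : C ∈ P) {i j : Fin n} (hi : i ∈ B) (hj : j ∈ C) :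
    p i = p j ↔ B = C := by
  induction h with
  | nil => simp at hB
  | @cons P w ps D hD hne hdisj hmax hpD hv hr h ih =>
    by_cases hBD : B = D <;> by_cases hCD : C = D
    · subst hBD hCD
      simp [hpD i hi, hpD j hj]
    · have h1 := h.mem_iff.2 ⟨C, Finset.mem_erase.2 ⟨hCD, hC⟩, j, hj, rfl⟩
      subst hBD
      refine ⟨fun h2 => ?_, fun h2 => absurd h2.symm hCD⟩
      rw [← h2, hpD i hi] at h1
      exact absurd h1 hv
    · have h1 := h.mem_iff.2 ⟨B, Finset.mem_erase.2 ⟨hBD, hB⟩, i, hi, rfl⟩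
      subst hCD
      refine ⟨fun h2 => ?_, fun h2 => absurd h2 hBD⟩
      rw [h2, hpD j hj] at h1
      exact absurd h1 hv
    · exact ih (Finset.mem_erase.2 ⟨hBD, hB⟩) (Finset.mem_erase.2 ⟨hCD, hC⟩)

theorem exists_iterate_eq (h : Decodes r p P ps) (hr : p r = r)
    (hps : ∀ x ∈ ps, x = r ∨ ∃ B ∈ P, x ∈ B) : ∀ B ∈ P, ∀ i ∈ B, ∃ k, p^[k] i = r := by
  induction h with
  | nil => simp
  | @cons P w ps D hD hne hdisj hmax hpD hv hwr h ih =>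
    -- The block `D` contains no entry, so the parent `w` of `D` is `r` or lies in a block removed
    -- later; thus parents lead to `r`.
    have hps' : ∀ x ∈ w :: ps, x = r ∨ ∃ B ∈ P.erase D, x ∈ B := by
      intro x hx
      refine (hps x hx).imp_right ?_
      rintro ⟨B, hB, hxB⟩
      refine ⟨B, Finset.mem_erase.2 ⟨?_, hB⟩, hxB⟩
      rintro rfl
      exact hdisj x hxB hx
    have ih' := ih fun x hx => hps' x (List.mem_cons_of_mem _ hx)
    intro B hB i hi
    by_cases hBD : B = D
    · subst hBD
      have h1 : ∃ k, p^[k] w = r := by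
        rcases hps' w List.mem_cons_self with rfl | ⟨C, hC, hw⟩
        · exact ⟨0, rfl⟩
        · exact ih' C hC w hw
      obtain ⟨k, hk⟩ := h1
      exact ⟨k + 1, by rwa [Function.iterate_succ_apply, hpD i hi]⟩
    · exact ih' B (Finset.mem_erase.2 ⟨hBD, hB⟩) i hi

end Decodes

/-- Pigeonhole: otherwise choosing an entry in each block injects the blocks into the entries other
than `r`, of which there is one fewer. -/
theorem exists_block_disjoint {r : Fin n} {P : Finset (Finset (Fin n))} {ps : List (Fin n)}
    (hP : (P : Set (Finset (Fin n))).PairwiseDisjoint id) (hr : ∀ B ∈ P, r ∉ B)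
    (hps : ps ∈ kPerms r P.card) (h0 : ps ≠ []) : ∃ B ∈ P, ∀ x ∈ B, x ∉ ps := by
  obtain ⟨h1, h2, h3⟩ := hps
  by_contra! hcon
  have hrps : r ∈ ps := by
    have h4 := h3 _ (List.getLast?_eq_some_getLast h0)
    exact h4 ▸ List.getLast_mem h0
  have : Nonempty (Fin n) := ⟨r⟩
  choose! g hgB hgps using hcon
  have hle : P.card ≤ (ps.toFinset.erase r).card := by
    refine Finset.card_le_card_of_injOn g (fun B hB => ?_) fun B hB C hC h => ?_
    · rw [Finset.mem_coe, Finset.mem_erase, List.mem_toFinset]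
      exact ⟨fun h => hr B hB (h ▸ hgB B hB), hgps B hB⟩
    · by_contra hne
      exact Finset.disjoint_left.1 (hP hB hC hne) (hgB B hB) (by rw [h]; exact hgB C hC)
  rw [Finset.card_erase_of_mem (List.mem_toFinset.2 hrps), List.toFinset_card_of_nodup h2,
    h1] at hle
  have := List.length_pos_iff.2 h0
  omega

theorem exists_decodes {r : Fin n} {P : Finset (Finset (Fin n))} {ps : List (Fin n)}
    (hP : (P : Set (Finset (Fin n))).PairwiseDisjoint id) (hr : ∀ B ∈ P, r ∉ B)
    (hne : ∀ B ∈ P, B.Nonempty) (hps : ps ∈ kPerms r P.card) : ∃ p, Decodes r p P ps := by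
  induction ps generalizing P with
  | nil =>
    have : P = ∅ := Finset.card_eq_zero.1 hps.1.symm
    subst this
    exact ⟨id, Decodes.nil⟩
  | cons v ps ih =>
    obtain ⟨B₀, hB₀, hB₀'⟩ := exists_block_disjoint hP hr hps (by simp)
    classical
    obtain ⟨B, hB, hmax⟩ := Finset.exists_max_image (P.filter fun B => ∀ x ∈ B, x ∉ v :: ps)
      (fun B => B.max) ⟨B₀, Finset.mem_filter.2 ⟨hB₀, hB₀'⟩⟩
    obtain ⟨hB, hB'⟩ := Finset.mem_filter.1 hB
    obtain ⟨h1, h2, h3⟩ := hps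
    rw [List.nodup_cons] at h2
    have hps' : ps ∈ kPerms r (P.erase B).card := by
      refine ⟨?_, h2.2, ?_⟩
      · rw [Finset.card_erase_of_mem hB, ← h1, List.length_cons, Nat.add_sub_cancel]
      · cases ps with
        | nil => simp
        | cons a ps => rwa [List.getLast?_cons_cons] at h3
    obtain ⟨p, hp⟩ := ih (Decodes.pairwiseDisjoint_erase hP B)
      (fun C hC => hr C (Finset.mem_of_mem_erase hC))
      (fun C hC => hne C (Finset.mem_of_mem_erase hC)) hps'
    refine ⟨fun i => if i ∈ B then v else p i, Decodes.cons hB (hne B hB) hB'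
      (fun B' h h' => hmax B' (Finset.mem_filter.2 ⟨h, h'⟩)) (fun i hi => if_pos hi) h2.1 ?_
      (hp.congr ?_)⟩
    · rintro rfl
      exact h3 v (by simp)
    · intro C hC i hi
      rw [Finset.mem_erase] at hC
      exact if_neg fun hiB => Finset.disjoint_left.1 (hP hC.2 hB hC.1) hi hiB

/-! ### The sequence of a tree decodes to its parent map -/

namespace IsParentMap

variable {r : Fin n} {T : SimpleGraph (Fin n)} {p : Fin n → Fin n}

theorem leafGroupParents_nonempty (hp : IsParentMap r T p) {V : Finset (Fin n)}
    (hV : ∀ i ∈ V, p i ∈ V) {i : Fin n} (hi : i ∈ V) (hir : i ≠ r) :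
    (leafGroupParents r T V).Nonempty := by
  -- The siblings of a deepest vertex are equally deep, hence all leaves.
  obtain ⟨c, hc, hmax⟩ := Finset.exists_max_image V (T.dist r) ⟨i, hi⟩
  have hcr : c ≠ r := by
    rintro rfl
    have h1 := hmax i hi
    have h2 := hp.dist_eq hir
    rw [SimpleGraph.dist_self] at h1
    omega
  refine ⟨p c, Finset.mem_filter.2 ⟨hV c hc, ⟨c, ?_⟩, fun d hd => ?_⟩⟩
  · exact Finset.mem_inter.2 ⟨hp.mem_childGroup.2 ⟨hcr, rfl⟩, hc⟩
  · rw [Finset.mem_inter, hp.mem_childGroup] at hd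
    refine Finset.eq_empty_of_forall_notMem fun j hj => ?_
    rw [Finset.mem_inter, hp.mem_childGroup] at hj
    have h1 := hmax j hj.2
    have h2 := hp.dist_eq hj.1.1
    have h3 := hp.dist_eq hd.1.1
    have h4 := hp.dist_eq hcr
    rw [hj.1.2] at h2
    rw [hd.1.2] at h3
    omega

/-- Deleting a leaf-group keeps `V` closed under parents, so the induction applies. The recorded
entries are the parents of the non-root vertices of `V`; hence leaf-groups are the blocks free of
entries. -/
theorem decodes_psiFrom (hp : IsParentMap r T p) (V : Finset (Fin n)) (hr : r ∈ V)
    (hV : ∀ i ∈ V, p i ∈ V) : Decodes r p (groupsOn r T V) (psiFrom r T V) := by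
  induction V using Finset.strongInduction with
  | H V ih =>
    rw [psiFrom]
    split_ifs with h
    · have hmem := largestLeafGroupParent_mem r T V h
      have hlargest : ∀ w ∈ leafGroupParents r T V, (childGroup r T w ∩ V).max ≤
          (childGroup r T (largestLeafGroupParent r T V h) ∩ V).max :=
        (Finset.exists_max_image _ (fun v => (childGroup r T v ∩ V).max) h).choose_spec.2
      generalize largestLeafGroupParent r T V h = v at *
      obtain ⟨hvV, hne, hleaf⟩ := Finset.mem_filter.1 hmem
      have hleaf' : ∀ i ∈ V, i ≠ r → p i ∉ childGroup r T v := by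
        intro i hi hir hpi
        have h1 := hleaf (p i) (Finset.mem_inter.2 ⟨hpi, hV i hi⟩)
        have h2 : i ∈ childGroup r T (p i) ∩ V :=
          Finset.mem_inter.2 ⟨hp.mem_childGroup.2 ⟨hir, rfl⟩, hi⟩
        rw [h1] at h2
        simp at h2
      have hrv : r ∉ childGroup r T v := fun h => (hp.mem_childGroup.1 h).1 rfl
      have hssub : V \ childGroup r T v ⊂ V := by
        refine Finset.ssubset_iff_subset_ne.2 ⟨Finset.sdiff_subset, fun he => ?_⟩
        obtain ⟨c, hc⟩ := hne
        rw [Finset.mem_inter] at hc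
        have hc' := hc.2
        rw [← he, Finset.mem_sdiff] at hc'
        exact hc'.2 hc.1
      have hdec := ih _ hssub (Finset.mem_sdiff.2 ⟨hr, hrv⟩) (by
        intro i hi
        rw [Finset.mem_sdiff] at hi ⊢
        refine ⟨hV i hi.1, ?_⟩
        by_cases hir : i = r
        · rwa [hir, hp.map_root]
        · exact hleaf' i hi.1 hir)
      have hgroups : groupsOn r T (V \ childGroup r T v) =
          (groupsOn r T V).erase (childGroup r T v ∩ V) := by
        have hinter : ∀ w, w ≠ v →
            childGroup r T w ∩ (V \ childGroup r T v) = childGroup r T w ∩ V := by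
          intro w hw
          ext i
          simp only [Finset.mem_inter, Finset.mem_sdiff, hp.mem_childGroup]
          constructor
          · tauto
          · rintro ⟨⟨h1, h2⟩, h3⟩
            exact ⟨⟨h1, h2⟩, h3, fun h4 => hw (h2.symm.trans h4.2)⟩
        have hempty : childGroup r T v ∩ (V \ childGroup r T v) = ∅ := by
          ext i
          simp only [Finset.mem_inter, Finset.mem_sdiff, Finset.notMem_empty, iff_false]
          tauto
        ext C
        rw [Finset.mem_erase, mem_groupsOn, mem_groupsOn]
        constructor
        · rintro ⟨hC, w, rfl⟩
          by_cases hw : w = v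
          · rw [hw, hempty] at hC
            simp at hC
          · rw [hinter w hw] at hC ⊢
            refine ⟨fun he => ?_, hC, w, rfl⟩
            obtain ⟨i, hi⟩ := hC
            have hi' := hi
            rw [he] at hi'
            rw [Finset.mem_inter, hp.mem_childGroup] at hi hi'
            exact hw (hi.1.2.symm.trans hi'.1.2)
        · rintro ⟨h1, hC, w, rfl⟩
          have hw : w ≠ v := fun hw => h1 (by rw [hw])
          exact ⟨hC, w, hinter w hw⟩
      have hps : ∀ {x}, x ∈ psiFrom r T (V \ childGroup r T v) ↔
          ∃ i ∈ V, i ≠ r ∧ i ∉ childGroup r T v ∧ p i = x := by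
        intro x
        rw [hdec.mem_iff]
        constructor
        · rintro ⟨C, hC, i, hi, rfl⟩
          obtain ⟨-, w, rfl⟩ := mem_groupsOn.1 hC
          rw [Finset.mem_inter, hp.mem_childGroup, Finset.mem_sdiff] at hi
          exact ⟨i, hi.2.1, hi.1.1, hi.2.2, rfl⟩
        · rintro ⟨i, hi, hir, hiv, rfl⟩
          have hi' : i ∈ childGroup r T (p i) ∩ (V \ childGroup r T v) :=
            Finset.mem_inter.2 ⟨hp.mem_childGroup.2 ⟨hir, rfl⟩, Finset.mem_sdiff.2 ⟨hi, hiv⟩⟩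
          exact ⟨_, mem_groupsOn.2 ⟨⟨i, hi'⟩, p i, rfl⟩, i, hi', rfl⟩
      have hcons : ∀ {x}, x ∈ v :: psiFrom r T (V \ childGroup r T v) ↔
          ∃ i ∈ V, i ≠ r ∧ p i = x := by
        intro x
        rw [List.mem_cons, hps]
        constructor
        · rintro (rfl | ⟨i, h1, h2, -, h3⟩)
          · obtain ⟨c, hc⟩ := hne
            rw [Finset.mem_inter, hp.mem_childGroup] at hc
            exact ⟨c, hc.2, hc.1⟩
          · exact ⟨i, h1, h2, h3⟩
        · rintro ⟨i, h1, h2, h3⟩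
          by_cases hi : i ∈ childGroup r T v
          · exact Or.inl (h3.symm.trans (hp.mem_childGroup.1 hi).2)
          · exact Or.inr ⟨i, h1, h2, hi, h3⟩
      rw [hgroups] at hdec
      refine Decodes.cons (mem_groupsOn.2 ⟨hne, v, rfl⟩) hne ?_ ?_ ?_ ?_ ?_ hdec
      · intro x hx hx'
        obtain ⟨i, h1, h2, rfl⟩ := hcons.1 hx'
        exact hleaf' i h1 h2 (Finset.mem_inter.1 hx).1
      · intro B' hB' hB''
        obtain ⟨hne', w, rfl⟩ := mem_groupsOn.1 hB'
        refine hlargest w (Finset.mem_filter.2 ⟨?_, hne', fun c hc => ?_⟩)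
        · obtain ⟨i, hi⟩ := hne'
          rw [Finset.mem_inter, hp.mem_childGroup] at hi
          exact hi.1.2 ▸ hV i hi.2
        · refine Finset.eq_empty_of_forall_notMem fun i hi => hB'' c hc (hcons.2 ?_)
          rw [Finset.mem_inter, hp.mem_childGroup] at hi
          exact ⟨i, hi.2, hi.1⟩
      · intro i hi
        exact (hp.mem_childGroup.1 (Finset.mem_inter.1 hi).1).2
      · intro hv
        obtain ⟨i, -, h2, h3, h4⟩ := hps.1 hv
        exact h3 (hp.mem_childGroup.2 ⟨h2, h4⟩)
      -- If `v ≠ r`, then `v` itself survives the deletion and its parent would still be recorded.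
      · intro hnil
        by_contra hvr
        have hv1 : v ∉ childGroup r T v := by
          obtain ⟨c, hc⟩ := hne
          rw [Finset.mem_inter, hp.mem_childGroup] at hc
          have := hleaf' c hc.2 hc.1.1
          rwa [hc.1.2] at this
        have := hps.2 ⟨v, hvV, hvr, hv1, rfl⟩
        rw [hnil] at this
        simp at this
    · have hempty : groupsOn r T V = ∅ := by
        refine Finset.eq_empty_of_forall_notMem fun B hB => ?_
        obtain ⟨⟨i, hi⟩, w, rfl⟩ := mem_groupsOn.1 hB
        rw [Finset.mem_inter, hp.mem_childGroup] at hi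
        exact h (hp.leafGroupParents_nonempty hV hi.2 hi.1.1)
      rw [hempty]
      exact Decodes.nil

theorem decodes_psi (hp : IsParentMap r T p) : Decodes r p (phiGlo r T) (psi r T) := by
  rw [← groupsOn_univ]
  exact hp.decodes_psiFrom _ (Finset.mem_univ r) fun _ _ => Finset.mem_univ _

end IsParentMap

theorem bijOn_psi {r : Fin n} (π : Finpartition (Finset.univ.erase r)) :
    Set.BijOn (psi r) (treesOfGlobalSibship r π.parts) (kPerms r π.parts.card) := by
  have hblock : ∀ i, i ≠ r → ∃ B ∈ π.parts, i ∈ B := fun i hi => π.exists_mem (by simpa using hi)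
  have hr : ∀ B ∈ π.parts, r ∉ B := fun B hB h => by simpa using π.subset hB h
  refine ⟨?_, ?_, ?_⟩
  · rintro T ⟨hT, hπ⟩
    obtain ⟨p, hp⟩ := exists_isParentMap r hT
    exact hπ ▸ hp.decodes_psi.mem_kPerms
  · rintro T ⟨hT, hπ⟩ T' ⟨hT', hπ'⟩ h
    obtain ⟨p, hp⟩ := exists_isParentMap r hT
    obtain ⟨p', hp'⟩ := exists_isParentMap r hT'
    have h1 := hp.decodes_psi
    have h2 := hp'.decodes_psi
    rw [hπ] at h1
    rw [hπ', ← h] at h2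
    have h3 : p = p' := by
      funext i
      by_cases hi : i = r
      · rw [hi, hp.map_root, hp'.map_root]
      · obtain ⟨B, hB, hiB⟩ := hblock i hi
        exact h1.eq_parent h2 π.disjoint B hB i hiB
    exact hp.graph_ext (h3 ▸ hp')
  · intro ps hps
    obtain ⟨p₀, hp₀⟩ := exists_decodes π.disjoint hr (fun B hB => π.nonempty_of_mem_parts hB) hps
    -- Decoding does not see the value at `r`, which lies in no block; it is reset to `r`.
    obtain ⟨p, hpr, hdec⟩ : ∃ p, p r = r ∧ Decodes r p π.parts ps := by
      refine ⟨Function.update p₀ r r, Function.update_self .., hp₀.congr fun B hB i hi => ?_⟩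
      exact Function.update_of_ne (fun (h : i = r) => hr B hB (h ▸ hi)) _ _
    have hreach : ∀ i, ∃ k, p^[k] i = r := by
      intro i
      by_cases hi : i = r
      · exact ⟨0, hi⟩
      · obtain ⟨B, hB, hiB⟩ := hblock i hi
        refine hdec.exists_iterate_eq hpr (fun x _ => ?_) B hB i hiB
        by_cases hx : x = r
        · exact Or.inl hx
        · exact Or.inr (hblock x hx)
    have hp := isParentMap_graphOfMap hpr hreach
    have hglo : phiGlo r (graphOfMap r p) = π.parts := by
      have hchild : ∀ B ∈ π.parts, ∀ i ∈ B, childGroup r (graphOfMap r p) (p i) = B := by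
        intro B hB i hi
        ext j
        rw [hp.mem_childGroup]
        constructor
        · rintro ⟨hj, hji⟩
          obtain ⟨C, hC, hjC⟩ := hblock j hj
          exact (hdec.parent_eq_iff hC hB hjC hi).1 hji ▸ hjC
        · exact fun hj => ⟨fun (h : j = r) => hr B hB (h ▸ hj), (hdec.parent_eq_iff hB hB hj hi).2 rfl⟩
      ext B
      rw [← groupsOn_univ, mem_groupsOn]
      constructor
      · rintro ⟨⟨i, hi⟩, v, rfl⟩
        rw [Finset.inter_univ] at hi ⊢
        obtain ⟨h1, rfl⟩ := hp.mem_childGroup.1 hi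
        obtain ⟨C, hC, hiC⟩ := hblock i h1
        rwa [hchild C hC i hiC]
      · intro hB
        obtain ⟨i, hi⟩ := π.nonempty_of_mem_parts hB
        exact ⟨⟨i, hi⟩, p i, by rw [Finset.inter_univ, hchild B hB i hi]⟩
    refine ⟨graphOfMap r p, ⟨hp.isTree, hglo⟩, ?_⟩
    have h1 := hp.decodes_psi
    rw [hglo] at h1
    exact h1.eq_list hdec π.disjoint

/-! ### Counting functions and set partitions -/

theorem card_eq_mul_of_fibers {X Y : Type*} [Finite X] [Finite Y] (f : X → Y) {c : ℕ}
    (h : ∀ y, Nat.card {x // f x = y} = c) : Nat.card X = Nat.card Y * c := by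
  classical
  have := Fintype.ofFinite X
  have := Fintype.ofFinite Y
  rw [← Nat.card_congr (Equiv.sigmaFiberEquiv f), Nat.card_sigma,
    Finset.sum_congr rfl fun y _ => h y, Finset.sum_const, smul_eq_mul, Finset.card_univ,
    Nat.card_eq_fintype_card]

section functions

variable {A J : Type*} [Finite A]

theorem exists_comp_perm_eq {g g' : A → J}
    (h : ∀ j, Nat.card {a // g a = j} = Nat.card {a // g' a = j}) :
    ∃ ρ : Equiv.Perm A, g' ∘ ρ = g :=
  ⟨Equiv.ofFiberEquiv fun j => Classical.choice (Finite.card_eq.1 (h j)),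
    funext fun a => Equiv.ofFiberEquiv_map _ a⟩

theorem exists_card_fiber_eq [Fintype J] {s : J → ℕ} (hs : ∑ j, s j = Nat.card A) :
    ∃ g : A → J, ∀ j, Nat.card {a // g a = j} = s j := by
  have h1 : Nat.card A = Nat.card (Σ j, Fin (s j)) := by simp [hs]
  obtain ⟨e⟩ := Finite.card_eq.1 h1
  refine ⟨fun a => (e a).1, fun j => ?_⟩
  have e1 : {a // (e a).1 = j} ≃ {x : Σ j, Fin (s j) // x.1 = j} :=
    e.subtypeEquiv fun a => Iff.rfl
  rw [Nat.card_congr e1, Nat.card_congr (Equiv.sigmaSubtype j), Nat.card_fin]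

/-- The multinomial number of functions with prescribed sizes of the fibers. -/
theorem card_functions_mul [Fintype J] {s : J → ℕ} (hs : ∑ j, s j = Nat.card A) :
    Nat.card {g : A → J // ∀ j, Nat.card {a // g a = j} = s j} * ∏ j, (s j).factorial =
      (Nat.card A).factorial := by
  classical
  have := Fintype.ofFinite A
  obtain ⟨g₀, h₀⟩ := exists_card_fiber_eq hs
  have hcomp : ∀ ρ : Equiv.Perm A, ∀ j, Nat.card {a // (g₀ ∘ ρ) a = j} = s j := by
    intro ρ j
    rw [← h₀ j]
    exact Nat.card_congr (ρ.subtypeEquiv fun a => Iff.rfl)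
  rw [← Nat.card_perm]
  refine (card_eq_mul_of_fibers (fun ρ => ⟨g₀ ∘ ρ, hcomp ρ⟩) ?_).symm
  rintro ⟨g, hg⟩
  obtain ⟨ρ₀, rfl⟩ := exists_comp_perm_eq (g := g) (g' := g₀) fun j => (hg j).trans (h₀ j).symm
  -- Each fiber of `ρ ↦ g₀ ∘ ρ` is a coset of the stabilizer of `g₀`, whose order is the product of
  -- the factorials of the fiber sizes.
  have e : {ρ : Equiv.Perm A // (⟨g₀ ∘ ρ, hcomp ρ⟩ :
      {g : A → J // ∀ j, Nat.card {a // g a = j} = s j}) = ⟨g₀ ∘ ρ₀, hg⟩} ≃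
      {ρ : Equiv.Perm A // g₀ ∘ ρ = g₀} := by
    refine (Equiv.mulRight ρ₀⁻¹).subtypeEquiv fun ρ => ?_
    rw [Subtype.mk.injEq, Equiv.coe_mulRight]
    constructor
    · intro h
      funext a
      simpa using congrFun h (ρ₀⁻¹ a)
    · intro h
      funext a
      simpa using congrFun h (ρ₀ a)
  rw [Nat.card_congr e, Nat.card_eq_fintype_card, DomMulAct.stabilizer_card]
  refine Finset.prod_congr rfl fun j _ => ?_
  rw [← h₀ j, Nat.card_eq_fintype_card]

end functions

section partitions

variable {α : Type*} {S : Finset α} {J : Type*}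

open Classical in
/-- The fiber over `j` of a function on `S`. -/
noncomputable def fiberBlock (g : S → J) (j : J) : Finset α :=
  (Finset.univ.filter fun a => g a = j).map (Function.Embedding.subtype _)

theorem mem_fiberBlock {g : S → J} {j : J} {x : α} :
    x ∈ fiberBlock g j ↔ ∃ h : x ∈ S, g ⟨x, h⟩ = j := by
  simp [fiberBlock]

theorem card_fiberBlock (g : S → J) (j : J) :
    (fiberBlock g j).card = Nat.card {a // g a = j} := by
  classical
  rw [fiberBlock, Finset.card_map, Nat.card_eq_fintype_card, Fintype.card_subtype]

theorem eq_of_mem_fiberBlock {g : S → J} {j k : J} {x : α} (hj : x ∈ fiberBlock g j)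
    (hk : x ∈ fiberBlock g k) : j = k := by
  obtain ⟨h, rfl⟩ := mem_fiberBlock.1 hj
  obtain ⟨_, rfl⟩ := mem_fiberBlock.1 hk
  rfl

theorem fiberBlock_injective {g : S → J} (hg : ∀ j, (fiberBlock g j).Nonempty) :
    Function.Injective (fiberBlock g) := by
  intro j k h
  obtain ⟨x, hx⟩ := hg j
  exact eq_of_mem_fiberBlock hx (h ▸ hx)

variable [DecidableEq α]

/-- The set of the fibers of a function on `S`. -/
noncomputable def fiberBlocks [Fintype J] (g : S → J) : Finset (Finset α) :=
  Finset.univ.image (fiberBlock g)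

theorem exists_finpartition_fiberBlocks [Fintype J] {g : S → J} (hg : ∀ j, (fiberBlock g j).Nonempty) :
    ∃ π : Finpartition S, π.parts = fiberBlocks g := by
  refine ⟨Finpartition.ofExistsUnique (fiberBlocks g) ?_ ?_ ?_, rfl⟩
  · simp only [fiberBlocks, Finset.mem_image, Finset.mem_univ, true_and, forall_exists_index,
      forall_apply_eq_imp_iff]
    intro j x hx
    exact (mem_fiberBlock.1 hx).1
  · intro a ha
    refine ⟨fiberBlock g (g ⟨a, ha⟩), ⟨Finset.mem_image_of_mem _ (Finset.mem_univ _),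
      mem_fiberBlock.2 ⟨ha, rfl⟩⟩, ?_⟩
    rintro B ⟨hB, haB⟩
    obtain ⟨j, -, rfl⟩ := Finset.mem_image.1 hB
    obtain ⟨_, rfl⟩ := mem_fiberBlock.1 haB
    rfl
  · intro h
    obtain ⟨j, -, hj⟩ := Finset.mem_image.1 h
    exact (hg j).ne_empty hj

theorem exists_perm_comp_eq [Fintype J] {g g₀ : S → J} (hg : ∀ j, (fiberBlock g j).Nonempty)
    (h : fiberBlocks g = fiberBlocks g₀) :
    ∃ σ : Equiv.Perm J, σ ∘ g₀ = g ∧ ∀ j, fiberBlock g₀ j = fiberBlock g (σ j) := by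
  have h1 : ∀ j, ∃ k, fiberBlock g₀ k = fiberBlock g j := by
    intro j
    have h2 : fiberBlock g j ∈ fiberBlocks g₀ :=
      h ▸ Finset.mem_image_of_mem _ (Finset.mem_univ _)
    obtain ⟨k, -, hk⟩ := Finset.mem_image.1 h2
    exact ⟨k, hk⟩
  choose τ hτ using h1
  have hinj : Function.Injective τ := by
    intro j k hjk
    refine fiberBlock_injective hg ?_
    rw [← hτ, ← hτ, hjk]
  let e : Equiv.Perm J := Equiv.ofBijective τ (Finite.injective_iff_bijective.1 hinj)
  refine ⟨e.symm, ?_, fun j => ?_⟩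
  · funext a
    rw [Function.comp_apply, Equiv.symm_apply_eq]
    have h3 : a.1 ∈ fiberBlock g (g a) := mem_fiberBlock.2 ⟨a.2, rfl⟩
    rw [← hτ] at h3
    exact (mem_fiberBlock.1 h3).2
  · rw [← hτ]
    exact congrArg _ (e.apply_symm_apply j).symm

/-- The set partitions of `S` with `m.count i` blocks of size `i` for each `i ≥ 1`. -/
def partitionsOfType (S : Finset α) (m : Multiset ℕ) : Set (Finset (Finset α)) :=
  {P | (∃ π : Finpartition S, π.parts = P) ∧
    ∀ i, 1 ≤ i → (P.filter fun B => B.card = i).card = m.count i}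

theorem card_subtype_coe_eq (m : Multiset ℕ) (i : ℕ) :
    Nat.card {j : m // j.1 = i} = m.count i := by
  rw [Nat.card_eq_fintype_card, Fintype.card_subtype]
  conv_rhs => rw [← Multiset.map_univ_coe m, Multiset.count_map]
  rw [Finset.card_def, Finset.filter_val]
  simp only [eq_comm]

theorem map_card_eq_of_mem_partitionsOfType {m : Multiset ℕ} (h0 : 0 ∉ m)
    {P : Finset (Finset α)} (hP : P ∈ partitionsOfType S m) : P.val.map Finset.card = m := by
  obtain ⟨⟨π, rfl⟩, h⟩ := hP
  ext i
  rw [Multiset.count_map]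
  by_cases hi : i = 0
  · subst hi
    rw [Multiset.count_eq_zero_of_notMem h0, Multiset.card_eq_zero, Multiset.filter_eq_nil]
    intro B hB
    exact (Finset.card_pos.2 (π.nonempty_of_mem_parts hB)).ne
  · rw [← h i (Nat.one_le_iff_ne_zero.2 hi), Finset.card_def, Finset.filter_val]
    simp only [eq_comm]

theorem card_eq_of_mem_partitionsOfType {m : Multiset ℕ} (h0 : 0 ∉ m)
    {P : Finset (Finset α)} (hP : P ∈ partitionsOfType S m) : P.card = m.card := by
  rw [← map_card_eq_of_mem_partitionsOfType h0 hP, Multiset.card_map, Finset.card_def]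

theorem exists_fiberBlocks_eq {m : Multiset ℕ} (h0 : 0 ∉ m) {P : Finset (Finset α)}
    (hP : P ∈ partitionsOfType S m) :
    ∃ g : S → m, (∀ j, (fiberBlock g j).card = j.1) ∧ fiberBlocks g = P := by
  have hmap := map_card_eq_of_mem_partitionsOfType h0 hP
  obtain ⟨⟨π, rfl⟩, -⟩ := hP
  -- Matching blocks with the indexed elements of `m` size by size gives the labelling `e`; `g`
  -- sends a point to the label of its block.
  have hcard : ∀ i, Nat.card {B : π.parts // B.1.card = i} = Nat.card {j : m // j.1 = i} := by
    intro i
    rw [card_subtype_coe_eq, ← hmap, Multiset.count_map, Nat.card_eq_fintype_card,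
      Fintype.card_subtype, Finset.card_def, Finset.filter_val]
    have h1 : π.parts.val = (Finset.univ : Finset π.parts).val.map Subtype.val := by
      have := congrArg Finset.val (Finset.attach_map_val (s := π.parts))
      simpa using this.symm
    conv_rhs => rw [h1, Multiset.filter_map, Multiset.card_map]
    simp only [eq_comm, Function.comp_def]
  let e : π.parts ≃ m :=
    Equiv.ofFiberEquiv fun i => Classical.choice (Finite.card_eq.1 (hcard i))
  have he : ∀ B, (e B).1 = B.1.card := fun B => Equiv.ofFiberEquiv_map _ B
  let g : S → m := fun a => e ⟨π.part a.1, (π.part_mem).2 a.2⟩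
  have hg : ∀ B, fiberBlock g (e B) = B.1 := by
    intro B
    ext x
    rw [mem_fiberBlock]
    constructor
    · rintro ⟨h, h1⟩
      rw [← e.injective h1]
      exact π.mem_part_self.2 h
    · intro hx
      refine ⟨π.subset B.2 hx, ?_⟩
      exact congrArg e (Subtype.ext (π.part_eq_of_mem B.2 hx))
  refine ⟨g, fun j => ?_, ?_⟩
  · obtain ⟨B, rfl⟩ := e.surjective j
    rw [hg, he]
  · ext B
    rw [fiberBlocks, Finset.mem_image]
    constructor
    · rintro ⟨j, -, rfl⟩
      obtain ⟨B, rfl⟩ := e.surjective j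
      rw [hg]
      exact B.2
    · exact fun hB => ⟨e ⟨B, hB⟩, Finset.mem_univ _, hg _⟩

theorem fiberBlocks_mem_partitionsOfType {m : Multiset ℕ} (h0 : 0 ∉ m) {g : S → m}
    (hg : ∀ j, (fiberBlock g j).card = j.1) : fiberBlocks g ∈ partitionsOfType S m := by
  have hne : ∀ j, (fiberBlock g j).Nonempty := by
    intro j
    rw [← Finset.card_pos, hg, Nat.pos_iff_ne_zero]
    exact fun h => h0 (h ▸ Multiset.coe_mem)
  refine ⟨exists_finpartition_fiberBlocks hne, fun i _ => ?_⟩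
  rw [fiberBlocks, Finset.filter_image, Finset.card_image_of_injective _ (fiberBlock_injective hne),
    ← card_subtype_coe_eq, Nat.card_eq_fintype_card, Fintype.card_subtype]
  simp only [hg]

/-- The number of set partitions of a given type. -/
theorem ncard_partitionsOfType_mul [Finite α] {m : Multiset ℕ} (h0 : 0 ∉ m)
    (hm : m.sum = S.card) :
    (partitionsOfType S m).ncard *
      ((∏ i ∈ m.toFinset, (m.count i).factorial) * (m.map Nat.factorial).prod) =
      S.card.factorial := by
  have hS : Nat.card S = S.card := by simp
  have hsum : ∑ j : m, j.1 = Nat.card S := by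
    rw [hS, ← hm]
    conv_rhs => rw [← Multiset.map_univ_coe m]
    rfl
  have hprod : ∏ j : m, j.1.factorial = (m.map Nat.factorial).prod := by
    rw [← Multiset.map_univ m Nat.factorial]
    rfl
  rw [← hS, ← card_functions_mul hsum, hprod, ← mul_assoc]
  congr 1
  have hmem : ∀ g : {g : S → m // ∀ j, Nat.card {a // g a = j} = j.1},
      fiberBlocks g.1 ∈ partitionsOfType S m := fun g =>
    fiberBlocks_mem_partitionsOfType h0 fun j => (card_fiberBlock _ _).trans (g.2 j)
  rw [← Nat.card_coe_set_eq]
  refine (card_eq_mul_of_fibers (fun g => (⟨fiberBlocks g.1, hmem g⟩ : partitionsOfType S m))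
    ?_).symm
  rintro ⟨P, hP⟩
  obtain ⟨g₀, h₀, rfl⟩ := exists_fiberBlocks_eq h0 hP
  -- The labellings of a fixed set partition by `m` form a free orbit under the permutations of `m`
  -- that preserve sizes; this is the order of that group.
  have hstab : Nat.card {σ : Equiv.Perm m // (fun j : m => j.1) ∘ σ = fun j => j.1} =
      ∏ i ∈ m.toFinset, (m.count i).factorial := by
    classical
    rw [Nat.card_eq_fintype_card, DomMulAct.stabilizer_card']
    refine Finset.prod_congr ?_ fun i _ => ?_
    · ext i
      simp only [Finset.mem_image, Finset.mem_univ, true_and, Multiset.mem_toFinset]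
      exact ⟨fun ⟨j, hj⟩ => hj ▸ Multiset.coe_mem,
        fun hi => ⟨⟨i, ⟨0, Multiset.count_pos.2 hi⟩⟩, rfl⟩⟩
    · rw [← card_subtype_coe_eq, Nat.card_eq_fintype_card]
  rw [← hstab]
  have hne : ∀ j, (fiberBlock g₀ j).Nonempty := by
    intro j
    rw [← Finset.card_pos, h₀, Nat.pos_iff_ne_zero]
    exact fun h => h0 (h ▸ Multiset.coe_mem)
  have hblock : ∀ (σ : Equiv.Perm m) j, fiberBlock (σ ∘ g₀) j = fiberBlock g₀ (σ.symm j) := by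
    intro σ j
    ext x
    simp only [mem_fiberBlock, Function.comp_apply, Equiv.eq_symm_apply]
  symm
  refine Nat.card_eq_of_bijective (fun σ : {σ : Equiv.Perm m // (fun j : m => j.1) ∘ σ =
    fun j => j.1} => ⟨⟨σ.1 ∘ g₀, fun j => ?_⟩, ?_⟩) ⟨?_, ?_⟩
  · rw [← card_fiberBlock, hblock, h₀]
    simpa using (congrFun σ.2 (σ.1.symm j)).symm
  · refine Subtype.ext ?_
    ext B
    simp only [fiberBlocks, Finset.mem_image, Finset.mem_univ, true_and, hblock]
    exact (σ.1.symm.surjective.exists (p := fun j => fiberBlock g₀ j = B)).symm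
  · intro σ σ' h
    refine Subtype.ext (Equiv.ext fun j => ?_)
    obtain ⟨x, hx⟩ := hne j
    obtain ⟨hxS, rfl⟩ := mem_fiberBlock.1 hx
    exact congrFun (congrArg (fun y => y.1.1) h) ⟨x, hxS⟩
  · rintro ⟨⟨g, hg⟩, hgP⟩
    have hgP' : fiberBlocks g = fiberBlocks g₀ := congrArg Subtype.val hgP
    have hg' : ∀ j, (fiberBlock g j).card = j.1 := fun j => (card_fiberBlock _ _).trans (hg j)
    have hgne : ∀ j, (fiberBlock g j).Nonempty := by
      intro j
      rw [← Finset.card_pos, hg', Nat.pos_iff_ne_zero]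
      exact fun h => h0 (h ▸ Multiset.coe_mem)
    obtain ⟨σ, rfl, h2⟩ := exists_perm_comp_eq hgne hgP'
    refine ⟨⟨σ, funext fun j => ?_⟩, rfl⟩
    rw [Function.comp_apply, ← hg', ← h2, h₀]

end partitions

/-! ### Counting sequences -/

/-- For `k > 0` the last entry is `r` and the others form an injection into the remaining `n - 1`
elements. For `k = 0` there is one sequence, and the formula needs `n = 1`. -/
theorem ncard_kPerms_mul (r : Fin n) {k : ℕ} (hk : k ≤ n) (h0 : k = 0 → n = 1) :
    (kPerms r k).ncard * (n - k).factorial = (n - 1).factorial := by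
  cases k with
  | zero =>
    have h1 : kPerms r 0 = {[]} := by
      ext l
      simp only [kPerms, Set.mem_ofPred_eq, Set.mem_singleton_iff, List.length_eq_zero_iff]
      exact ⟨fun h => h.1, by rintro rfl; simp⟩
    rw [h1, Set.ncard_singleton, h0 rfl]
    rfl
  | succ k =>
    have hinj : Function.Injective fun f : Fin k ↪ {x : Fin n // x ≠ r} =>
        List.ofFn (fun i => (f i).1) ++ [r] := by
      intro f f' h
      have h1 := List.ofFn_injective (List.append_cancel_right h)
      exact DFunLike.ext _ _ fun i => Subtype.ext (congrFun h1 i)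
    have hrange : kPerms r (k + 1) = Set.range fun f : Fin k ↪ {x : Fin n // x ≠ r} =>
        List.ofFn (fun i => (f i).1) ++ [r] := by
      ext l
      constructor
      · rintro ⟨h1, h2, h3⟩
        have hne : l ≠ [] := by
          rintro rfl
          simp at h1
        have h4 := h3 _ (List.getLast?_eq_some_getLast hne)
        obtain ⟨l', rfl⟩ : ∃ l', l = l' ++ [r] :=
          ⟨l.dropLast, by rw [← h4, List.dropLast_append_getLast]⟩
        rw [List.nodup_append] at h2
        have h5 : l'.length = k := by simpa using h1
        subst h5
        refine ⟨⟨fun i => ⟨l'.get i, fun h => ?_⟩, fun i j h => ?_⟩, ?_⟩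
        · exact h2.2.2 _ (List.get_mem l' i) r (by simp) h
        · exact List.nodup_iff_injective_get.1 h2.1 (congrArg Subtype.val h)
        · exact congrArg (· ++ [r]) (List.ofFn_get l')
      · rintro ⟨f, rfl⟩
        refine ⟨by simp, ?_, by simp⟩
        rw [List.nodup_append]
        refine ⟨List.nodup_ofFn.2 fun i j h => f.injective (Subtype.ext h), by simp, ?_⟩
        intro a ha b hb
        obtain ⟨i, rfl⟩ := List.mem_ofFn.1 ha
        rw [List.mem_singleton] at hb
        exact hb ▸ (f i).2
    rw [hrange, Set.ncard_range_of_injective hinj, Nat.card_eq_fintype_card,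
      Fintype.card_embedding_eq, Fintype.card_fin, Fintype.card_subtype_compl,
      Fintype.card_subtype_eq, Fintype.card_fin, mul_comm]
    have h1 : n - (k + 1) = n - 1 - k := by omega
    rw [h1, Nat.factorial_mul_descFactorial (by omega)]

/-! ### Local indegrees and local sibships -/

namespace IsParentMap

variable {r : Fin n} {T : SimpleGraph (Fin n)} {p : Fin n → Fin n}

theorem card_localSibship (hp : IsParentMap r T p) (v : Fin n) :
    (localSibship r T v).card = localIndeg T v := by
  classical
  -- A label is sent to the smaller end of its edge. The label `v` and a child `k` cannot collide,
  -- since `p v = k` and `p k = v` contradict the distances.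
  refine Finset.card_bij (fun k _ => if k = v then p v else k) ?_ ?_ ?_
  · intro k hk
    obtain ⟨hkr, hk⟩ := hp.mem_localSibship.1 hk
    rw [Finset.mem_filter]
    refine ⟨Finset.mem_univ _, ?_⟩
    unfold LocalArc
    split_ifs with h
    · subst h
      exact ⟨(hp.globalArc hkr).1.symm,
        lt_of_le_of_ne (max_eq_left_iff.1 hk) (hp.map_ne hkr)⟩
    · have h1 : p k = v := hk ▸ ((max_choice k (p k)).resolve_left fun h1 => h (h1 ▸ hk)).symm
      exact ⟨h1 ▸ (hp.globalArc hkr).1, lt_of_le_of_ne (hk ▸ le_max_left _ _) h⟩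
  · have key : ∀ k, k ≠ r → max k (p k) = v → k ≠ v → v ≠ r → p v ≠ k := by
      intro k hkr hk hkv hvr h
      have h1 : p k = v := hk ▸ ((max_choice k (p k)).resolve_left fun h1 => hkv (h1 ▸ hk)).symm
      have h2 := hp.dist_eq hkr
      have h3 := hp.dist_eq hvr
      rw [h1] at h2
      rw [h] at h3
      omega
    intro k hk l hl h
    obtain ⟨hkr, hk⟩ := hp.mem_localSibship.1 hk
    obtain ⟨hlr, hl⟩ := hp.mem_localSibship.1 hl
    split_ifs at h with h1 h2 h2
    · rw [h1, h2]
    · exact absurd h (key l hlr hl h2 (h1 ▸ hkr))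
    · exact absurd h.symm (key k hkr hk h1 (h2 ▸ hlr))
    · exact h
  · intro i hi
    obtain ⟨hadj, hlt⟩ := (Finset.mem_filter.1 hi).2
    rcases hp.adj_iff.1 hadj with ⟨hir, hiv⟩ | ⟨hvr, hvi⟩
    · exact ⟨i, hp.mem_localSibship.2 ⟨hir, by rw [hiv, max_eq_right hlt.le]⟩, if_neg hlt.ne⟩
    · exact ⟨v, hp.mem_localSibship.2 ⟨hvr, by rw [hvi, max_eq_left hlt.le]⟩,
        by rw [if_pos rfl, hvi]⟩

theorem exists_finpartition_phiLoc (hp : IsParentMap r T p) :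
    ∃ π : Finpartition (Finset.univ.erase r), π.parts = phiLoc r T := by
  refine ⟨Finpartition.ofExistsUnique (phiLoc r T) ?_ ?_ (by simp [phiLoc]), rfl⟩
  · intro B hB k hk
    obtain ⟨v, -, rfl⟩ := Finset.mem_image.1 (Finset.mem_of_mem_erase hB)
    exact Finset.mem_erase.2 ⟨(hp.mem_localSibship.1 hk).1, Finset.mem_univ _⟩
  · intro k hk
    have hkr := Finset.ne_of_mem_erase hk
    have hmem : k ∈ localSibship r T (max k (p k)) := hp.mem_localSibship.2 ⟨hkr, rfl⟩
    refine ⟨localSibship r T (max k (p k)), ⟨Finset.mem_erase.2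
      ⟨Finset.ne_empty_of_mem hmem, Finset.mem_image_of_mem _ (Finset.mem_univ _)⟩, hmem⟩, ?_⟩
    rintro B ⟨hB, hkB⟩
    obtain ⟨v, -, rfl⟩ := Finset.mem_image.1 (Finset.mem_of_mem_erase hB)
    rw [(hp.mem_localSibship.1 hkB).2]

theorem card_filter_localIndeg (hp : IsParentMap r T p) {i : ℕ} (hi : 1 ≤ i) :
    (Finset.univ.filter fun v => localIndeg T v = i).card =
      ((phiLoc r T).filter fun B => B.card = i).card := by
  refine Finset.card_bij (fun v _ => localSibship r T v) ?_ ?_ ?_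
  · intro v hv
    have hv' := (Finset.mem_filter.1 hv).2
    rw [← hp.card_localSibship] at hv'
    refine Finset.mem_filter.2 ⟨Finset.mem_erase.2 ⟨?_,
      Finset.mem_image_of_mem _ (Finset.mem_univ _)⟩, hv'⟩
    rw [← Finset.nonempty_iff_ne_empty, ← Finset.card_pos]
    omega
  · intro v hv w _ h
    have hv' := (Finset.mem_filter.1 hv).2
    rw [← hp.card_localSibship] at hv'
    obtain ⟨k, hk⟩ := Finset.card_pos.1 (by omega : 0 < (localSibship r T v).card)
    have hkw : k ∈ localSibship r T w := h ▸ hk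
    exact (hp.mem_localSibship.1 hk).2.symm.trans (hp.mem_localSibship.1 hkw).2
  · intro B hB
    obtain ⟨hB, hBi⟩ := Finset.mem_filter.1 hB
    obtain ⟨v, -, rfl⟩ := Finset.mem_image.1 (Finset.mem_of_mem_erase hB)
    exact ⟨v, Finset.mem_filter.2 ⟨Finset.mem_univ _, hp.card_localSibship v ▸ hBi⟩, rfl⟩

end IsParentMap

/-! ### Assembling the bijections and the counts -/

theorem mem_treesOfLocalType_iff (r : Fin n) {lam : Nat.Partition (n - 1)}
    {T : SimpleGraph (Fin n)} :
    T ∈ treesOfLocalType lam ↔ T.IsTree ∧ phiLoc r T ∈ setPartitionsOfType r lam := by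
  refine and_congr_right fun hT => ?_
  obtain ⟨p, hp⟩ := exists_isParentMap r hT
  constructor
  · exact fun h => ⟨hp.exists_finpartition_phiLoc, fun i hi => by
      rw [← hp.card_filter_localIndeg hi, h i hi]⟩
  · exact fun h i hi => by rw [hp.card_filter_localIndeg hi, h.2 i hi]

theorem zero_notMem_parts {m : ℕ} (lam : Nat.Partition m) : 0 ∉ lam.parts :=
  fun h => (lam.parts_pos h).ne rfl

theorem card_eq_of_mem_setPartitionsOfType {r : Fin n} {lam : Nat.Partition (n - 1)}
    {P : Finset (Finset (Fin n))} (hP : P ∈ setPartitionsOfType r lam) :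
    P.card = lam.parts.card :=
  card_eq_of_mem_partitionsOfType (zero_notMem_parts lam) hP

theorem bijOn_code (r : Fin n) (lam : Nat.Partition (n - 1)) :
    Set.BijOn (code r) (treesOfLocalType lam)
      (setPartitionsOfType r lam ×ˢ kPerms r lam.parts.card) := by
  have hphi : ∀ {T : SimpleGraph (Fin n)}, T ∈ treesOfLocalType lam →
      phiGlo r (Phi r T) = phiLoc r T := fun hT =>
    (exists_isParentMap r hT.1).choose_spec.phiGlo_phi
  have hglo : ∀ {T : SimpleGraph (Fin n)}, T ∈ treesOfLocalType lam →
      Phi r T ∈ treesOfGlobalSibship r (phiLoc r T) := fun hT =>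
    (bijOn_phi_sibship r _).mapsTo ⟨hT.1, rfl⟩
  refine ⟨fun T hT => ?_, fun T hT T' hT' h => ?_, ?_⟩
  · have h1 := ((mem_treesOfLocalType_iff r).1 hT).2
    have h0 : phiGlo r (Phi r T) ∈ setPartitionsOfType r lam := (hphi hT).symm ▸ h1
    refine ⟨h0, ?_⟩
    rw [← card_eq_of_mem_setPartitionsOfType h1]
    obtain ⟨π, hπ⟩ := h1.1
    have h2 := hglo hT
    rw [← hπ] at h2 ⊢
    exact (bijOn_psi π).mapsTo h2
  · have h1 : phiGlo r (Phi r T) = phiGlo r (Phi r T') := congrArg Prod.fst h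
    have h2 : psi r (Phi r T) = psi r (Phi r T') := congrArg Prod.snd h
    rw [hphi hT, hphi hT'] at h1
    obtain ⟨π, hπ⟩ := ((mem_treesOfLocalType_iff r).1 hT).2.1
    refine (bijOn_phi r).injOn hT.1 hT'.1 ((bijOn_psi π).injOn ?_ ?_ h2)
    · exact hπ ▸ hglo hT
    · rw [hπ, h1]
      exact hglo hT'
  · rintro ⟨P, ps⟩ ⟨hP, hps⟩
    have hcard := card_eq_of_mem_setPartitionsOfType hP
    obtain ⟨⟨π, rfl⟩, hP'⟩ := id hP
    simp only at hps
    rw [← hcard] at hps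
    obtain ⟨T', hT', rfl⟩ := (bijOn_psi π).surjOn hps
    obtain ⟨T, hT, rfl⟩ := (bijOn_phi_sibship r _).surjOn hT'
    refine ⟨T, (mem_treesOfLocalType_iff r).2 ⟨hT.1, hT.2.symm ▸ hP⟩, ?_⟩
    exact Prod.ext hT'.2 rfl

theorem ncard_treesOfLocalSibship_mul {r : Fin n} (π : Finpartition (Finset.univ.erase r)) :
    (treesOfLocalSibship r π.parts).ncard * (n - π.parts.card).factorial =
      (n - 1).factorial := by
  have hn : 0 < n := r.pos
  have hle : π.parts.card ≤ n - 1 := by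
    have := π.card_parts_le_card
    rwa [Finset.card_erase_of_mem (Finset.mem_univ r), Finset.card_univ, Fintype.card_fin] at this
  rw [(bijOn_phi_sibship r _).ncard_eq, (bijOn_psi π).ncard_eq]
  refine ncard_kPerms_mul r (by omega) fun h => ?_
  rw [Finset.card_eq_zero, Finpartition.parts_eq_empty_iff] at h
  have := congrArg Finset.card h
  rw [Finset.card_erase_of_mem (Finset.mem_univ r), Finset.card_univ, Fintype.card_fin,
    Finset.bot_eq_empty, Finset.card_empty] at this
  omega

theorem prod_multiplicity (hn : 0 < n) (lam : Nat.Partition (n - 1)) :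
    ∏ i ∈ Finset.range n, ((multiplicity lam i).factorial * i.factorial ^ multiplicity lam i) =
      (n - lam.parts.card).factorial *
        ((∏ i ∈ lam.parts.toFinset, (lam.parts.count i).factorial) *
          (lam.parts.map Nat.factorial).prod) := by
  -- The factor at `0` is `e₀!`, because `0! = 1`; indices that are not parts contribute `1`, and
  -- all parts are below `n`.
  rw [Finset.prod_multiset_map_count, ← Finset.prod_mul_distrib,
    ← Finset.mul_prod_erase _ _ (Finset.mem_range.2 hn)]
  congr 1
  · simp [multiplicity]
  · refine (Finset.prod_subset ?_ ?_).symm.trans (Finset.prod_congr rfl ?_)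
    · intro i hi
      rw [Multiset.mem_toFinset] at hi
      have h1 := lam.parts_pos hi
      have h2 := Multiset.single_le_sum (fun _ _ => Nat.zero_le _) i hi
      rw [lam.parts_sum] at h2
      rw [Finset.mem_erase, Finset.mem_range]
      omega
    · intro i hi hi'
      rw [Multiset.mem_toFinset] at hi'
      simp [multiplicity, Finset.ne_of_mem_erase hi, Multiset.count_eq_zero_of_notMem hi']
    · intro i hi
      simp [multiplicity, (lam.parts_pos (Multiset.mem_toFinset.1 hi)).ne']

theorem ncard_treesOfLocalType_mul (r : Fin n) (lam : Nat.Partition (n - 1)) :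
    (treesOfLocalType lam).ncard *
      ∏ i ∈ Finset.range n, ((multiplicity lam i).factorial * i.factorial ^ multiplicity lam i) =
      (n - 1).factorial ^ 2 := by
  have hn : 0 < n := r.pos
  have hcard : ((Finset.univ : Finset (Fin n)).erase r).card = n - 1 := by
    rw [Finset.card_erase_of_mem (Finset.mem_univ r), Finset.card_univ, Fintype.card_fin]
  have hle : lam.parts.card ≤ n - 1 := by
    have := Multiset.card_nsmul_le_sum (s := lam.parts) (a := 1) fun i hi => lam.parts_pos hi
    rwa [lam.parts_sum, smul_eq_mul, mul_one] at this
  have h1 := ncard_partitionsOfType_mul (S := (Finset.univ : Finset (Fin n)).erase r)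
    (zero_notMem_parts lam) (lam.parts_sum.trans hcard.symm)
  have h2 := ncard_kPerms_mul r (k := lam.parts.card) (by omega) fun h => by
    have h3 := lam.parts_sum
    rw [Multiset.card_eq_zero.1 h, Multiset.sum_zero] at h3
    omega
  rw [hcard] at h1
  rw [prod_multiplicity hn, (bijOn_code r lam).ncard_eq, Set.ncard_prod, sq]
  nth_rw 1 [← h2]
  rw [← h1]
  -- `setPartitionsOfType r lam` unfolds to `partitionsOfType` on the complement of `r`.
  change (partitionsOfType _ _).ncard * _ * _ = _
  ring

end LabeledTree

theorem mainTheorem3 (n : ℕ) [NeZero n] :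
    (∀ lam : Nat.Partition (n - 1),
      Set.BijOn (LabeledTree.code (0 : Fin n))
        (LabeledTree.treesOfLocalType lam)
        (LabeledTree.setPartitionsOfType (0 : Fin n) lam ×ˢ
          LabeledTree.kPerms (0 : Fin n) lam.parts.card) ∧
      ((LabeledTree.treesOfLocalType lam).ncard : ℚ) =
        ((n - 1).factorial : ℚ) ^ 2 /
          ∏ i ∈ Finset.range n,
            ((LabeledTree.multiplicity lam i).factorial : ℚ) *
              (i.factorial : ℚ) ^ LabeledTree.multiplicity lam i) ∧
    (∀ π : Finpartition ((Finset.univ : Finset (Fin n)).erase 0),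
      Set.BijOn (LabeledTree.Phi (0 : Fin n))
        (LabeledTree.treesOfLocalSibship 0 π.parts)
        (LabeledTree.treesOfGlobalSibship 0 π.parts) ∧
      Set.BijOn (LabeledTree.psi (0 : Fin n))
        (LabeledTree.treesOfGlobalSibship 0 π.parts)
        (LabeledTree.kPerms (0 : Fin n) π.parts.card) ∧
      ((LabeledTree.treesOfLocalSibship 0 π.parts).ncard : ℚ) =
        ((n - 1).factorial : ℚ) / ((n - π.parts.card).factorial : ℚ)) := by
  refine ⟨fun lam => ⟨LabeledTree.bijOn_code 0 lam, ?_⟩,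
    fun π => ⟨LabeledTree.bijOn_phi_sibship 0 _, LabeledTree.bijOn_psi π, ?_⟩⟩
  · rw [eq_div_iff (Finset.prod_ne_zero_iff.2 fun i _ => by positivity)]
    exact_mod_cast LabeledTree.ncard_treesOfLocalType_mul 0 lam
  · rw [eq_div_iff (by positivity)]
    exact_mod_cast LabeledTree.ncard_treesOfLocalSibship_mul π
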